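/- Let $m,n\ge 0$ and let $d\ge 0$ be integers, and let $S(\mathbb C^d\otimes\mathbb C^{m|n})=\mathbb C[x,\eta]$ be the polynomial superalgebra in even variables $x_i^j$ and odd variables $\eta_k^j$ ($1\le i\le m$, $1\le k\le n$, $1\le j\le d$). Write $z_p^j$ ($1\le p\le m+n$) for these variables ($x$ for $p\le m$, $\eta$ for $p>m$), and put $|p|=0$ for $p\le m$ and $|p|=1$ for $p>m$. Consider the operators $$E_{pq}=\sum_{j=1}^d z_p^j\frac{\partial}{\partial z_q^j}+(-1)^{|p|}\frac d2\,\delta_{pq},\qquad I_{pq}=\sum_{j=1}^d s_j\,z_p^jz_q^{d+1-j},\qquad \Delta_{pq}=\sum_{j=1}^d s_j\,\frac{\partial}{\partial z_p^j}\frac{\partial}{\partial z_q^{d+1-j}}.$$ If all $s_j=1$, they define an action of the Lie superalgebra $spo(2m|2n)$ (the endomorphisms of $\mathbb C^{2m|2n}$ that preserve a nondegenerate skew-supersymmetric bilinear form) on $\mathbb C[x,\eta]$, which commutes with $O(d)$. If $d$ is even and $s_j=1$ for $j\le d/2$, $s_j=-1$ for $j>d/2$, they define an action of $osp(2m|2n)$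 (supersymmetric bilinear form), which commutes with $Sp(d)$. These actions give the decompositions $$\mathbb C[x,\eta]\cong\bigoplus_\lambda V^\lambda_{O(d)}\otimes V^{\lambda'}_{spo(2m|2n)},\qquad \mathbb C[x,\eta]\cong\bigoplus_\lambda V^\lambda_{Sp(d)}\otimes V^{\lambda'}_{osp(2m|2n)}\quad(d\text{ even}).$$ Let $\dagger$ be the conjugate-linear anti-involution of $spo(2m|2n)$, respectively $osp(2m|2n)$ (with $[a,b]^\dagger=[b^\dagger,a^\dagger]$ and $a^{\dagger\dagger}=a$, without super signs), that is induced by the anti-involution of the algebra of differential operators on $\mathbb C[x,\eta]$ exchanging $x_i^j\leftrightarrow\partial/\partial x_i^j$ and $\eta_k^j\leftrightarrow\partial/\partial\eta_k^j$. A module $V$ is called unitarizable if it carries a positive definite Hermitian form with $(av|w)=(v|a^\dagger w)$ for all $v,w\in V$ and all $a$ in the Lie superalgebra. Then every $spo(2m|2n)$-module that is isomorphic to a submodule of $S(\mathbb C^d\otimes\mathbb C^{m|n})$ and, for $d$ even, every $osp(2m|2n)$-module that is isomorphic to a submodule of $S(\mathbb C^d\otimes\mathbb C^{m|n})$ is unitarizable.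 In particular, all the modules $V^{\lambda'}_{spo(2m|2n)}$ and $V^{\lambda'}_{osp(2m|2n)}$ that occur in the decompositions above are unitarizable. -/

import Mathlib

open scoped TensorProduct ComplexConjugate

noncomputable section

namespace HoweSuper

/-! ## Lie superalgebras, modules, anti-involutions, unitarizability -/

/-- The sign `(-1)^a` for `a : ℤ/2`; thus `(-1)^{ab}` is `sg (a * b)`. -/
def sg (a : ZMod 2) : ℂ := (-1) ^ a.val

/-- A complex Lie superalgebra `L = L₀ ⊕ L₁`. -/
class LieSuperalgebra (L : Type*) [AddCommGroup L] [Module ℂ L] where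
  part : ZMod 2 → Submodule ℂ L
  isCompl_part : IsCompl (part 0) (part 1)
  bracket : L →ₗ[ℂ] L →ₗ[ℂ] L
  bracket_mem : ∀ a b x y, x ∈ part a → y ∈ part b → bracket x y ∈ part (a + b)
  bracket_skew : ∀ a b x y, x ∈ part a → y ∈ part b →
    bracket x y = -(sg (a * b) • bracket y x)
  jacobi : ∀ a b x y z, x ∈ part a → y ∈ part b →
    bracket x (bracket y z) = bracket (bracket x y) z + sg (a * b) • bracket y (bracket x z)

open LieSuperalgebra

/-- A module `V = V₀ ⊕ V₁` over a Lie superalgebra. -/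
structure SuperModule (L : Type*) [AddCommGroup L] [Module ℂ L] [LieSuperalgebra L]
    (V : Type*) [AddCommGroup V] [Module ℂ V] where
  grade : ZMod 2 → Submodule ℂ V
  isCompl_grade : IsCompl (grade 0) (grade 1)
  act : L →ₗ[ℂ] V →ₗ[ℂ] V
  act_mem : ∀ a b x v, x ∈ part a → v ∈ grade b → act x v ∈ grade (a + b)
  act_bracket : ∀ a b x y v, x ∈ part a → y ∈ part b →
    act (bracket x y) v = act x (act y v) - sg (a * b) • act y (act x v)

/-- A conjugate-linear anti-involution of a Lie superalgebra, without super signs: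
`[x, y]† = [y†, x†]` and `x†† = x`. -/
structure AntiInvolution (L : Type*) [AddCommGroup L] [Module ℂ L] [LieSuperalgebra L] where
  dagger : L →ₗ⋆[ℂ] L
  dagger_mem : ∀ a x, x ∈ part a → dagger x ∈ part a
  dagger_bracket : ∀ x y, dagger (bracket x y) = bracket (dagger y) (dagger x)
  dagger_dagger : ∀ x, dagger (dagger x) = x

section Modules

variable {L : Type*} [AddCommGroup L] [Module ℂ L] [LieSuperalgebra L]
variable {V : Type*} [AddCommGroup V] [Module ℂ V]
variable {W : Type*} [AddCommGroup W] [Module ℂ W]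

/-- `M` occurs in `N`: it is isomorphic to a subspace of `N` that is stable under the action.  The
embedding is not required to preserve the parity. -/
def SuperModule.OccursIn (M : SuperModule L V) (N : SuperModule L W) : Prop :=
  ∃ φ : V →ₗ[ℂ] W, Function.Injective φ ∧ ∀ x v, φ (M.act x v) = N.act x (φ v)

/-- `M` is unitarizable with respect to the anti-involution `†`: there is a positive definite
Hermitian form on `V` with `(x v | w) = (v | x† w)`. -/
def SuperModule.IsUnitarizable (M : SuperModule L V) (τ : AntiInvolution L) : Prop :=
  ∃ form : V →ₗ[ℂ] V →ₗ⋆[ℂ] ℂ,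
    (∀ v w, form w v = conj (form v w)) ∧
    (∀ v, v ≠ 0 → 0 < (form v v).re) ∧
    (∀ x v w, form (M.act x v) w = form v (M.act (τ.dagger x) w))

end Modules

/-! ## Matrix Lie superalgebras preserving a bilinear form -/

theorem sg_zero : sg 0 = 1 := by simp [sg]

theorem sg_one : sg 1 = -1 := by simp [sg, ZMod.val_one]

theorem zmod_two_cases (a : ZMod 2) : a = 0 ∨ a = 1 := by
  revert a; decide

theorem sg_add (a b : ZMod 2) : sg (a + b) = sg a * sg b := by
  have h : (1 + 1 : ZMod 2) = 0 := rfl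
  rcases zmod_two_cases a with rfl | rfl <;> rcases zmod_two_cases b with rfl | rfl <;>
    simp [h, sg_zero, sg_one]

theorem sg_mul_self (a : ZMod 2) : sg a * sg a = 1 := by
  rw [← sg_add, CharTwo.add_self_eq_zero, sg_zero]

theorem star_sg (a : ZMod 2) : conj (sg a) = sg a := by simp [sg]

section Matrices

set_option linter.unusedSectionVars false

variable {ι : Type*} [Fintype ι] [DecidableEq ι] (par : ι → ZMod 2)

/-- The homogeneous component of degree `a` of an endomorphism of the superspace with homogeneous
basis indexed by `ι`, the `i`-th basis vector having degree `par i`. -/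
def comp (a : ZMod 2) : Matrix ι ι ℂ →ₗ[ℂ] Matrix ι ι ℂ where
  toFun X := Matrix.of fun i j => if par i + par j = a then X i j else 0
  map_add' X Y := by
    ext i j; by_cases h : par i + par j = a <;> simp [h]
  map_smul' c X := by
    ext i j; by_cases h : par i + par j = a <;> simp [h]

/-- The supercommutator on `gl`: `[X, Y] = X Y - (-1)^{ab} Y X` for `X` of degree `a` and `Y` of
degree `b`, extended bilinearly. -/
def superBracket : Matrix ι ι ℂ →ₗ[ℂ] Matrix ι ι ℂ →ₗ[ℂ] Matrix ι ι ℂ :=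
  ∑ a : ZMod 2, ∑ b : ZMod 2,
    ((LinearMap.mul ℂ (Matrix ι ι ℂ)).compl₁₂ (comp par a) (comp par b) -
      sg (a * b) • ((LinearMap.mul ℂ (Matrix ι ι ℂ)).flip.compl₁₂ (comp par a) (comp par b)))

/-- The linear maps preserving the bilinear form with Gram matrix `G`, `G i j = (e_i | e_j)`:
each homogeneous component `A`, of degree `a`, satisfies
`(A v | w) + (-1)^{a deg v} (v | A w) = 0`. -/
def ortho (G : Matrix ι ι ℂ) : Submodule ℂ (Matrix ι ι ℂ) where
  carrier := {X | ∀ a i j, ∑ k, comp par a X k i * G k j +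
    sg (a * par i) * ∑ k, G i k * comp par a X k j = 0}
  zero_mem' := by intro a i j; simp
  add_mem' := by
    intro X Y hX hY a i j
    have := congrArg₂ (· + ·) (hX a i j) (hY a i j)
    simp only [map_add, Matrix.add_apply, add_mul, mul_add, Finset.sum_add_distrib] at this ⊢
    linear_combination this
  smul_mem' := by
    intro c X hX a i j
    have := congrArg (c * ·) (hX a i j)
    simp only [map_smul, Matrix.smul_apply, smul_eq_mul, mul_add, Finset.mul_sum] at this ⊢
    rw [mul_zero] at this
    rw [← this]
    congr 1 <;> refine Finset.sum_congr rfl fun k _ => by ring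

variable {par}

theorem comp_apply (a : ZMod 2) (X : Matrix ι ι ℂ) (i j : ι) :
    comp par a X i j = if par i + par j = a then X i j else 0 := rfl

theorem comp_add_comp (X : Matrix ι ι ℂ) : comp par 0 X + comp par 1 X = X := by
  ext i j
  have h : ∀ a : ZMod 2, (if a = 0 then X i j else 0) + (if a = 1 then X i j else 0) = X i j := by
    intro a; rcases zmod_two_cases a with rfl | rfl <;> simp
  exact h _

theorem comp_comp (a b : ZMod 2) (X : Matrix ι ι ℂ) :
    comp par a (comp par b X) = if a = b then comp par b X else 0 := by
  ext i j
  by_cases h : a = b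
  · subst h; simp only [comp_apply, if_true]; split_ifs <;> rfl
  · simp only [comp_apply, if_neg h, Matrix.zero_apply]
    split_ifs with h1 h2
    · exact absurd (h1.symm.trans h2) h
    · rfl
    · rfl

theorem comp_mul {a b : ZMod 2} {X Y : Matrix ι ι ℂ} (hX : comp par a X = X)
    (hY : comp par b Y = Y) : comp par (a + b) (X * Y) = X * Y := by
  ext i j
  rw [comp_apply]
  split_ifs with h
  · rfl
  · rw [Matrix.mul_apply]
    refine (Finset.sum_eq_zero fun k _ => ?_).symm
    rw [← hX, ← hY, comp_apply, comp_apply]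
    split_ifs with h1 h2
    · exact absurd (by rw [← h1, ← h2, add_assoc, ← add_assoc (par k),
        CharTwo.add_self_eq_zero, zero_add]) h
    all_goals simp

theorem superBracket_of_homog {a b : ZMod 2} {X Y : Matrix ι ι ℂ} (hX : comp par a X = X)
    (hY : comp par b Y = Y) : superBracket par X Y = X * Y - sg (a * b) • (Y * X) := by
  have h1 : ∀ c, comp par c X = if c = a then X else 0 := fun c => by
    conv_lhs => rw [← hX, comp_comp]
    rw [hX]
  have h2 : ∀ c, comp par c Y = if c = b then Y else 0 := fun c => by
    conv_lhs => rw [← hY, comp_comp]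
    rw [hY]
  simp only [superBracket, LinearMap.sum_apply, LinearMap.sub_apply, LinearMap.smul_apply,
    LinearMap.compl₁₂_apply, LinearMap.flip_apply, LinearMap.mul_apply', h1, h2]
  rw [Finset.sum_eq_single a, Finset.sum_eq_single b]
  · simp
  · intro c _ hc; simp [hc]
  · simp
  · intro c _ hc; simp [hc]
  · simp

theorem comp_superBracket {a b : ZMod 2} {X Y : Matrix ι ι ℂ} (hX : comp par a X = X)
    (hY : comp par b Y = Y) : comp par (a + b) (superBracket par X Y) = superBracket par X Y := by
  rw [superBracket_of_homog hX hY, map_sub, map_smul, comp_mul hX hY, add_comm a b,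
    comp_mul hY hX]

theorem mem_ortho_iff {G : Matrix ι ι ℂ} {X : Matrix ι ι ℂ} :
    X ∈ ortho par G ↔ ∀ a, (comp par a X).transpose * G +
      Matrix.diagonal (fun i => sg (a * par i)) * G * comp par a X = 0 := by
  refine forall_congr' fun a => ?_
  rw [← Matrix.ext_iff]
  refine forall_congr' fun i => forall_congr' fun j => ?_
  rw [Matrix.add_apply, Matrix.mul_assoc, Matrix.diagonal_mul, Matrix.mul_apply, Matrix.mul_apply]
  rfl

theorem comp_mem_ortho {G : Matrix ι ι ℂ} {X : Matrix ι ι ℂ} (hX : X ∈ ortho par G)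
    (a : ZMod 2) : comp par a X ∈ ortho par G := by
  rw [mem_ortho_iff] at hX ⊢
  intro b
  rw [comp_comp]
  split_ifs with h
  · subst h; exact hX _
  · simp

theorem mem_ortho_of_homog {G : Matrix ι ι ℂ} {a : ZMod 2} {X : Matrix ι ι ℂ}
    (hX : comp par a X = X) : X ∈ ortho par G ↔ X.transpose * G =
      -(Matrix.diagonal (fun i => sg (a * par i)) * G * X) := by
  rw [mem_ortho_iff, ← add_eq_zero_iff_eq_neg]
  constructor
  · intro h; simpa [hX] using h a
  · intro h b
    rw [← hX, comp_comp]
    split_ifs with hb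
    · subst hb; rw [hX]; exact h
    · simp

theorem transpose_mul_diag {a b : ZMod 2} {Y : Matrix ι ι ℂ} (hY : comp par b Y = Y) :
    Y.transpose * Matrix.diagonal (fun i => sg (a * par i)) =
      sg (a * b) • (Matrix.diagonal (fun i => sg (a * par i)) * Y.transpose) := by
  ext i j
  rw [Matrix.mul_diagonal, Matrix.smul_apply, Matrix.diagonal_mul, Matrix.transpose_apply, ← hY,
    comp_apply]
  split_ifs with h
  · rw [← h, mul_add, sg_add, smul_eq_mul]
    have := sg_mul_self (a * par i)
    linear_combination (-sg (a * par j) * Y j i) * this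
  · simp

theorem superBracket_mem_ortho_of_homog {G : Matrix ι ι ℂ} {a b : ZMod 2} {X Y : Matrix ι ι ℂ}
    (hX : comp par a X = X) (hY : comp par b Y = Y) (hX' : X ∈ ortho par G)
    (hY' : Y ∈ ortho par G) : superBracket par X Y ∈ ortho par G := by
  rw [mem_ortho_of_homog (comp_superBracket hX hY), superBracket_of_homog hX hY]
  rw [mem_ortho_of_homog hX] at hX'
  rw [mem_ortho_of_homog hY] at hY'
  set D : ZMod 2 → Matrix ι ι ℂ := fun a => Matrix.diagonal (fun i => sg (a * par i)) with hD
  have hDD : D (a + b) = D a * D b := by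
    simp only [hD, Matrix.diagonal_mul_diagonal, add_mul, sg_add]
  have hDc : D b * D a = D a * D b := by
    simp only [hD, Matrix.diagonal_mul_diagonal, mul_comm]
  have e1 : (X * Y).transpose * G = sg (a * b) • (D a * D b * G * Y * X) := by
    rw [Matrix.transpose_mul, Matrix.mul_assoc, hX', Matrix.mul_neg, ← Matrix.mul_assoc,
      ← Matrix.mul_assoc, transpose_mul_diag hY]
    rw [Matrix.smul_mul, Matrix.smul_mul, Matrix.mul_assoc (Matrix.diagonal _), hY']
    simp only [Matrix.mul_neg, Matrix.neg_mul, smul_neg, neg_neg, Matrix.mul_assoc, hD]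
  have e2 : (Y * X).transpose * G = sg (a * b) • (D a * D b * G * X * Y) := by
    rw [Matrix.transpose_mul, Matrix.mul_assoc, hY', Matrix.mul_neg, ← Matrix.mul_assoc,
      ← Matrix.mul_assoc, transpose_mul_diag hX, ← hDc, mul_comm b a]
    rw [Matrix.smul_mul, Matrix.smul_mul, Matrix.mul_assoc (Matrix.diagonal _), hX']
    simp only [Matrix.mul_neg, Matrix.neg_mul, smul_neg, neg_neg, Matrix.mul_assoc, hD]
  have hs := sg_mul_self (a * b)
  change _ = -(D (a + b) * G * _)
  rw [Matrix.transpose_sub, Matrix.transpose_smul, Matrix.sub_mul, Matrix.smul_mul, e1, e2, hDD,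
    smul_smul, hs, one_smul, Matrix.mul_sub, Matrix.mul_smul, neg_sub, ← Matrix.mul_assoc,
    ← Matrix.mul_assoc]

theorem superBracket_eq_sum (X Y : Matrix ι ι ℂ) : superBracket par X Y =
    superBracket par (comp par 0 X) (comp par 0 Y) + superBracket par (comp par 0 X) (comp par 1 Y)
    + superBracket par (comp par 1 X) (comp par 0 Y)
    + superBracket par (comp par 1 X) (comp par 1 Y) := by
  conv_lhs => rw [← comp_add_comp (par := par) X, ← comp_add_comp (par := par) Y]
  simp only [map_add, LinearMap.add_apply]
  abel

theorem comp_comp_self (a : ZMod 2) (X : Matrix ι ι ℂ) :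
    comp par a (comp par a X) = comp par a X := by rw [comp_comp, if_pos rfl]

theorem superBracket_mem_ortho {G : Matrix ι ι ℂ} {X Y : Matrix ι ι ℂ}
    (hX : X ∈ ortho par G) (hY : Y ∈ ortho par G) : superBracket par X Y ∈ ortho par G := by
  rw [superBracket_eq_sum]
  refine add_mem (add_mem (add_mem ?_ ?_) ?_) ?_ <;>
    exact superBracket_mem_ortho_of_homog (comp_comp_self _ _) (comp_comp_self _ _)
      (comp_mem_ortho hX _) (comp_mem_ortho hY _)

theorem superBracket_jacobi_homog {a b c : ZMod 2} {X Y Z : Matrix ι ι ℂ}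
    (hX : comp par a X = X) (hY : comp par b Y = Y) (hZ : comp par c Z = Z) :
    superBracket par X (superBracket par Y Z) = superBracket par (superBracket par X Y) Z +
      sg (a * b) • superBracket par Y (superBracket par X Z) := by
  rw [superBracket_of_homog hX (comp_superBracket hY hZ),
    superBracket_of_homog (comp_superBracket hX hY) hZ,
    superBracket_of_homog hY (comp_superBracket hX hZ), superBracket_of_homog hX hY,
    superBracket_of_homog hX hZ, superBracket_of_homog hY hZ]
  simp only [mul_add, add_mul, sg_add, mul_sub, sub_mul, smul_sub, smul_mul_assoc, mul_smul_comm,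
    smul_smul, mul_assoc, mul_comm b a]
  have h := sg_mul_self (a * b)
  have e1 : sg (a * b) * (sg (a * b) * sg (b * c)) = sg (b * c) := by
    linear_combination sg (b * c) * h
  have e2 : sg (a * b) * (sg (a * b) * (sg (b * c) * sg (a * c))) = sg (a * c) * sg (b * c) := by
    linear_combination (sg (b * c) * sg (a * c)) * h
  rw [e1, e2]
  module

/-- The Lie superalgebra of linear maps preserving a bilinear form, with the supercommutator. -/
instance (G : Matrix ι ι ℂ) : LieSuperalgebra (ortho par G) where
  part a := LinearMap.eqLocus ((comp par a).comp (ortho par G).subtype) (ortho par G).subtype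
  isCompl_part := by
    constructor
    · rw [Submodule.disjoint_def]
      intro X h0 h1
      have h0' : comp par 0 X.1 = X.1 := h0
      have h1' : comp par 1 X.1 = X.1 := h1
      ext1
      have := comp_comp (par := par) 0 1 X.1
      rw [h1', h0', if_neg (by decide)] at this
      exact this
    · rw [codisjoint_iff, eq_top_iff]
      intro X _
      refine Submodule.mem_sup.2 ⟨⟨_, comp_mem_ortho X.2 0⟩, comp_comp_self _ _,
        ⟨_, comp_mem_ortho X.2 1⟩, comp_comp_self _ _, ?_⟩
      ext1
      exact comp_add_comp _
  bracket := LinearMap.mk₂ ℂ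
    (fun X Y => ⟨superBracket par X.1 Y.1, superBracket_mem_ortho X.2 Y.2⟩)
    (fun _ _ _ => by ext1; simp) (fun _ _ _ => by ext1; simp)
    (fun _ _ _ => by ext1; simp) (fun _ _ _ => by ext1; simp)
  bracket_mem a b X Y hX hY := comp_superBracket hX hY
  bracket_skew a b X Y hX hY := by
    ext1
    change superBracket par X.1 Y.1 = -(sg (a * b) • superBracket par Y.1 X.1)
    have hX' : comp par a X.1 = X.1 := hX
    have hY' : comp par b Y.1 = Y.1 := hY
    rw [superBracket_of_homog hX' hY', superBracket_of_homog hY' hX', mul_comm b a, smul_sub,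
      smul_smul, sg_mul_self, one_smul, neg_sub]
  jacobi a b X Y Z hX hY := by
    ext1
    change superBracket par X.1 (superBracket par Y.1 Z.1) =
      superBracket par (superBracket par X.1 Y.1) Z.1 +
      sg (a * b) • superBracket par Y.1 (superBracket par X.1 Z.1)
    have hX' : comp par a X.1 = X.1 := hX
    have hY' : comp par b Y.1 = Y.1 := hY
    have h0 := superBracket_jacobi_homog (par := par) hX' hY' (comp_comp_self 0 Z.1)
    have h1 := superBracket_jacobi_homog (par := par) hX' hY' (comp_comp_self 1 Z.1)
    have := congrArg₂ (· + ·) h0 h1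
    beta_reduce at this
    conv_lhs => rw [← comp_add_comp (par := par) Z.1]
    conv_rhs => rw [← comp_add_comp (par := par) Z.1]
    simp only [map_add, smul_add]
    rw [this]
    abel

end Matrices

/-! ## The Lie superalgebras `spo(2m|2n)` and `osp(2m|2n)` -/

/-- Index set of the standard homogeneous basis of `ℂ^{m|n}`. -/
abbrev Idx (m n : ℕ) := Fin m ⊕ Fin n

/-- The degrees of the basis vectors of `ℂ^{m|n}`. -/
def par {m n : ℕ} : Idx m n → ZMod 2 := Sum.elim (fun _ => 0) (fun _ => 1)

/-- Index set of a homogeneous basis `e_p, e_p*` of `ℂ^{2m|2n} = ℂ^{m|n} ⊕ (ℂ^{m|n})*`: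
`Sum.inl p` is `e_p` and `Sum.inr p` is `e_p*`. -/
abbrev DIdx (m n : ℕ) := Idx m n ⊕ Idx m n

/-- The degrees of the basis vectors of `ℂ^{2m|2n}`. -/
def dpar {m n : ℕ} : DIdx m n → ZMod 2 := Sum.elim par par

/-- The bilinear form on `ℂ^{2m|2n}` with `(e_p | e_q*) = δ_{pq}`,
`(e_p* | e_q) = -τ (-1)^{deg p} δ_{pq}`, and all other values `0`.  For `τ = 1` it is
skew-supersymmetric (skew-symmetric on the even part, symmetric on the odd part), for `τ = -1`
supersymmetric. -/
def superForm (m n : ℕ) (τ : ℂ) : Matrix (DIdx m n) (DIdx m n) ℂ :=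
  Matrix.fromBlocks 0 1 (Matrix.diagonal fun p => -τ * sg (par p)) 0

/-- `spo(2m|2n)`: preserves a nondegenerate skew-supersymmetric form. -/
abbrev spo (m n : ℕ) : Submodule ℂ (Matrix (DIdx m n) (DIdx m n) ℂ) :=
  ortho dpar (superForm m n 1)

/-- `osp(2m|2n)`: preserves a nondegenerate supersymmetric form. -/
abbrev osp (m n : ℕ) : Submodule ℂ (Matrix (DIdx m n) (DIdx m n) ℂ) :=
  ortho dpar (superForm m n (-1))

section Dagger

variable {m n : ℕ}

/-- The diagonal entries of `K = diag(1, …, 1 | K*)`, where `K*` is `-1` on the even and `1` on the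
odd vectors `e_p*`. -/
def daggerSign : DIdx m n → ℂ := Sum.elim (fun _ => 1) (fun p => -sg (par p))

/-- The conjugate-linear map `X ↦ K Xᴴ K` of matrices. -/
def matDagger : Matrix (DIdx m n) (DIdx m n) ℂ →ₗ⋆[ℂ] Matrix (DIdx m n) (DIdx m n) ℂ where
  toFun X := Matrix.diagonal daggerSign * X.conjTranspose * Matrix.diagonal daggerSign
  map_add' X Y := by rw [Matrix.conjTranspose_add, Matrix.mul_add, Matrix.add_mul]
  map_smul' c X := by
    rw [Matrix.conjTranspose_smul, Matrix.mul_smul, Matrix.smul_mul]; rfl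

theorem matDagger_apply (X : Matrix (DIdx m n) (DIdx m n) ℂ) (i j : DIdx m n) :
    matDagger X i j = daggerSign i * conj (X j i) * daggerSign j := by
  change (Matrix.diagonal daggerSign * X.conjTranspose * Matrix.diagonal daggerSign :
    Matrix (DIdx m n) (DIdx m n) ℂ) i j = _
  rw [Matrix.mul_diagonal, Matrix.diagonal_mul]; rfl

theorem daggerSign_mul_self (i : DIdx m n) : daggerSign i * daggerSign i = 1 := by
  rcases i with p | p <;> simp [daggerSign, sg_mul_self]

theorem conj_daggerSign (i : DIdx m n) : conj (daggerSign i) = daggerSign i := by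
  rcases i with p | p <;> simp [daggerSign, star_sg]

theorem matDagger_mul (X Y : Matrix (DIdx m n) (DIdx m n) ℂ) :
    matDagger (X * Y) = matDagger Y * matDagger X := by
  have h : Matrix.diagonal (daggerSign (m := m) (n := n)) * Matrix.diagonal daggerSign = 1 := by
    rw [Matrix.diagonal_mul_diagonal, ← Matrix.diagonal_one]
    exact congrArg _ (funext daggerSign_mul_self)
  change Matrix.diagonal daggerSign * (X * Y).conjTranspose * Matrix.diagonal daggerSign =
    (Matrix.diagonal daggerSign * Y.conjTranspose * Matrix.diagonal daggerSign) *
    (Matrix.diagonal daggerSign * X.conjTranspose * Matrix.diagonal daggerSign)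
  rw [Matrix.conjTranspose_mul]
  simp only [Matrix.mul_assoc]
  rw [← Matrix.mul_assoc (Matrix.diagonal daggerSign) (Matrix.diagonal daggerSign), h,
    Matrix.one_mul]

theorem matDagger_matDagger (X : Matrix (DIdx m n) (DIdx m n) ℂ) :
    matDagger (matDagger X) = X := by
  ext i j
  rw [matDagger_apply, matDagger_apply, map_mul, map_mul, conj_daggerSign, conj_daggerSign,
    Complex.conj_conj]
  linear_combination X i j * (daggerSign j * daggerSign j * daggerSign_mul_self i +
    daggerSign_mul_self j)

theorem comp_matDagger (a : ZMod 2) (X : Matrix (DIdx m n) (DIdx m n) ℂ) :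
    comp dpar a (matDagger X) = matDagger (comp dpar a X) := by
  ext i j
  rw [matDagger_apply, comp_apply, comp_apply, add_comm (dpar j), matDagger_apply]
  split_ifs <;> simp

/-- The value `(e_i | e_i*)` of the form on a basis vector and its dual partner. -/
def formCoeff (τ : ℂ) : DIdx m n → ℂ := Sum.elim (fun _ => 1) (fun p => -τ * sg (par p))

theorem superForm_apply (τ : ℂ) (i j : DIdx m n) :
    superForm m n τ i j = if j = i.swap then formCoeff τ i else 0 := by
  rcases i with p | p <;> rcases j with q | q <;>
    simp [superForm, formCoeff, Matrix.one_apply, Matrix.diagonal_apply, eq_comm]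

theorem mem_ortho_superForm {τ : ℂ} {a : ZMod 2} {X : Matrix (DIdx m n) (DIdx m n) ℂ}
    (hX : comp dpar a X = X) : X ∈ ortho dpar (superForm m n τ) ↔ ∀ i j,
      X j.swap i * formCoeff τ j.swap + sg (a * dpar i) * (formCoeff τ i * X i.swap j) = 0 := by
  have key : ∀ (Y : Matrix (DIdx m n) (DIdx m n) ℂ) (b : ZMod 2) (i j : DIdx m n),
      ∑ k, Y k i * superForm m n τ k j + sg (b * dpar i) * ∑ k, superForm m n τ i k * Y k j =
      Y j.swap i * formCoeff τ j.swap + sg (b * dpar i) * (formCoeff τ i * Y i.swap j) := by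
    intro Y b i j
    congr 1
    · rw [Finset.sum_eq_single j.swap]
      · rw [superForm_apply, if_pos (Sum.swap_swap j).symm]
      · intro k _ hk
        rw [superForm_apply, if_neg, mul_zero]
        rintro rfl
        exact hk (Sum.swap_swap k).symm
      · simp
    · rw [Finset.sum_eq_single i.swap]
      · rw [superForm_apply, if_pos rfl]
      · intro k _ hk
        rw [superForm_apply, if_neg hk, zero_mul]
      · simp
  constructor
  · intro h i j
    have := h a i j
    rwa [hX, key] at this
  · intro h b i j
    rw [key, ← hX, comp_comp]
    split_ifs with hb
    · subst hb; rw [hX]; exact h i j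
    · simp

theorem dpar_swap (i : DIdx m n) : dpar i.swap = dpar i := by
  rcases i with p | p <;> rfl

theorem daggerSign_swap (i : DIdx m n) :
    daggerSign i.swap = -sg (dpar i) * daggerSign i := by
  rcases i with p | p <;> simp [daggerSign, dpar, sg_mul_self]

theorem formCoeff_swap {τ : ℂ} (i : DIdx m n) :
    formCoeff τ i * formCoeff τ i.swap = -τ * sg (dpar i) := by
  rcases i with p | p <;> simp [formCoeff, dpar]

theorem formCoeff_mul_self {τ : ℂ} (hτ : τ * τ = 1) (i : DIdx m n) :
    formCoeff τ i * formCoeff τ i = 1 := by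
  rcases i with p | p
  · simp [formCoeff]
  · simp only [formCoeff, Sum.elim_inr]
    linear_combination hτ * (sg (par p) * sg (par p)) + sg_mul_self (par p)

theorem conj_formCoeff {τ : ℂ} (hτ' : conj τ = τ) (i : DIdx m n) :
    conj (formCoeff τ i) = formCoeff τ i := by
  rcases i with p | p <;> simp [formCoeff, star_sg, hτ']

theorem zmod_two_mul_self (a : ZMod 2) : a * a = a := by revert a; decide

theorem matDagger_mem {τ : ℂ} (hτ : τ * τ = 1) (hτ' : conj τ = τ)
    {X : Matrix (DIdx m n) (DIdx m n) ℂ} (hX : X ∈ ortho dpar (superForm m n τ)) :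
    matDagger X ∈ ortho dpar (superForm m n τ) := by
  rw [← comp_add_comp (par := dpar) (matDagger X)]
  have main : ∀ a, comp dpar a (matDagger X) ∈ ortho dpar (superForm m n τ) := by
    intro a
    rw [comp_matDagger]
    have h1 := comp_mem_ortho hX a
    have h0 := comp_comp_self (par := dpar) a X
    generalize comp dpar a X = Y at h0 h1
    have h2 : comp dpar a (matDagger Y) = matDagger Y := by rw [comp_matDagger, h0]
    rw [mem_ortho_superForm h0] at h1
    rw [mem_ortho_superForm h2]
    intro i j
    have h3 := congrArg conj (h1 j.swap i.swap)
    simp only [Sum.swap_swap, map_add, map_mul, conj_formCoeff hτ', star_sg, map_zero,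
      dpar_swap] at h3
    rw [matDagger_apply, matDagger_apply, daggerSign_swap, daggerSign_swap]
    by_cases hd : dpar i + dpar j = a
    · have ei : sg (a * dpar i) = sg (dpar i) * sg (dpar i * dpar j) := by
        rw [← hd, add_mul, zmod_two_mul_self, sg_add, mul_comm (dpar j)]
      have ej : sg (a * dpar j) = sg (dpar j) * sg (dpar i * dpar j) := by
        rw [← hd, add_mul, zmod_two_mul_self, sg_add, mul_comm]
      rw [ej] at h3
      rw [ei]
      have g1 := formCoeff_mul_self hτ i
      have g2 := formCoeff_mul_self hτ j.swap
      have s1 := sg_mul_self (dpar i)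
      have s2 := sg_mul_self (dpar j)
      have s3 := sg_mul_self (dpar i * dpar j)
      generalize sg (dpar i) = si at *
      generalize sg (dpar j) = sj at *
      generalize sg (dpar i * dpar j) = sij at *
      generalize formCoeff τ i = fi at *
      generalize formCoeff τ j.swap = fj at *
      generalize daggerSign i = ki at *
      generalize daggerSign j = kj at *
      generalize conj (Y i j.swap) = u at *
      generalize conj (Y j i.swap) = v at *
      linear_combination (-ki * kj * sj * fi * fj) * h3 + ki * kj * sj * u * fj * g1 +
        ki * kj * sij * fi * v * (fj * fj * s2 + g2 - s1)
    · have z : ∀ k l, dpar k = dpar i → dpar l = dpar j → Y k l = 0 := by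
        intro k l hk hl
        rw [← h0, comp_apply, if_neg (by rw [hk, hl]; exact hd)]
      have z' : ∀ k l, dpar k = dpar j → dpar l = dpar i → Y k l = 0 := by
        intro k l hk hl
        rw [← h0, comp_apply, if_neg (by rw [hk, hl, add_comm]; exact hd)]
      rw [z i j.swap rfl (dpar_swap j), z' j i.swap rfl (dpar_swap i)]
      simp
  exact add_mem (main 0) (main 1)

theorem matDagger_superBracket (X Y : Matrix (DIdx m n) (DIdx m n) ℂ) :
    matDagger (superBracket dpar X Y) = superBracket dpar (matDagger Y) (matDagger X) := by
  have key : ∀ a b, matDagger (superBracket dpar (comp dpar a X) (comp dpar b Y)) =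
      superBracket dpar (comp dpar b (matDagger Y)) (comp dpar a (matDagger X)) := by
    intro a b
    rw [superBracket_of_homog (comp_comp_self _ _) (comp_comp_self _ _),
      superBracket_of_homog (comp_comp_self _ _) (comp_comp_self _ _), map_sub,
      LinearMap.map_smulₛₗ, star_sg, matDagger_mul, matDagger_mul, comp_matDagger,
      comp_matDagger, mul_comm a b]
  rw [superBracket_eq_sum X Y, superBracket_eq_sum (matDagger Y) (matDagger X)]
  simp only [map_add, key]
  abel

/-- The anti-involution `X ↦ K Xᴴ K` of the Lie superalgebra preserving `superForm m n τ`.  On the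
operators `E`, `I`, `Δ` by which this Lie superalgebra acts on `ℂ[x, η]` below, it is the restriction
of the conjugate-linear anti-involution of the Weyl-Clifford algebra that exchanges `x` with `∂/∂x`
and `η` with `∂/∂η`. -/
def formDagger (τ : ℂ) (hτ : τ * τ = 1) (hτ' : conj τ = τ) :
    AntiInvolution (ortho dpar (superForm m n τ)) where
  dagger :=
    { toFun := fun X => ⟨matDagger X.1, matDagger_mem hτ hτ' X.2⟩
      map_add' := fun X Y => Subtype.ext (map_add matDagger X.1 Y.1)
      map_smul' := fun c X => Subtype.ext (LinearMap.map_smulₛₗ matDagger c X.1) }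
  dagger_mem a X hX := by
    have hX' : comp dpar a X.1 = X.1 := hX
    change comp dpar a (matDagger X.1) = matDagger X.1
    rw [comp_matDagger, hX']
  dagger_bracket X Y := Subtype.ext (matDagger_superBracket X.1 Y.1)
  dagger_dagger X := Subtype.ext (matDagger_matDagger X.1)

end Dagger

/-! ## The polynomial superalgebra `S(ℂ^d ⊗ ℂ^{m|n}) = ℂ[x, η]` -/

/-- `ℂ[x, η]`: polynomials in the even variables `x_i^j` tensor the exterior algebra on the odd
variables `η_k^j`, for `1 ≤ j ≤ d`, `1 ≤ i ≤ m`, `1 ≤ k ≤ n`. -/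
def PolySuper (d m n : ℕ) : Type :=
  MvPolynomial (Fin d × Fin m) ℂ ⊗[ℂ] ExteriorAlgebra ℂ (Fin d × Fin n → ℂ)

instance (d m n : ℕ) : AddCommGroup (PolySuper d m n) :=
  inferInstanceAs (AddCommGroup
    (MvPolynomial (Fin d × Fin m) ℂ ⊗[ℂ] ExteriorAlgebra ℂ (Fin d × Fin n → ℂ)))

instance (d m n : ℕ) : Module ℂ (PolySuper d m n) :=
  inferInstanceAs (Module ℂ
    (MvPolynomial (Fin d × Fin m) ℂ ⊗[ℂ] ExteriorAlgebra ℂ (Fin d × Fin n → ℂ)))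

section Operators

variable {d m n : ℕ}

/-- The product `f w` of a polynomial `f` in the `x_i^j` and an element `w` of the exterior algebra
on the `η_k^j`. -/
def PolySuper.mk (f : MvPolynomial (Fin d × Fin m) ℂ)
    (w : ExteriorAlgebra ℂ (Fin d × Fin n → ℂ)) : PolySuper d m n := f ⊗ₜ[ℂ] w

/-- The linear map `f w ↦ S(f) T(w)`. -/
def PolySuper.map (S : Module.End ℂ (MvPolynomial (Fin d × Fin m) ℂ))
    (T : Module.End ℂ (ExteriorAlgebra ℂ (Fin d × Fin n → ℂ))) :
    Module.End ℂ (PolySuper d m n) := TensorProduct.map S T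

/-- Left multiplication by `x_i^j` or `η_k^j`. -/
def mulOp (j : Fin d) : Idx m n → Module.End ℂ (PolySuper d m n)
  | Sum.inl i => PolySuper.map (LinearMap.mulLeft ℂ (MvPolynomial.X (j, i))) LinearMap.id
  | Sum.inr k => PolySuper.map LinearMap.id
      (LinearMap.mulLeft ℂ (ExteriorAlgebra.ι ℂ (Pi.single (j, k) 1)))

/-- The derivation `∂/∂x_i^j` or the left odd derivation `∂/∂η_k^j`. -/
def diffOp (j : Fin d) : Idx m n → Module.End ℂ (PolySuper d m n)
  | Sum.inl i => PolySuper.map (MvPolynomial.pderiv (j, i)).toLinearMap LinearMap.id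
  | Sum.inr k => PolySuper.map LinearMap.id
      (CliffordAlgebra.contractLeft (Q := (0 : QuadraticForm ℂ (Fin d × Fin n → ℂ)))
        (LinearMap.proj (j, k)))

/-- The parity operator, `1` on even and `-1` on odd elements. -/
def parityOp : Module.End ℂ (PolySuper d m n) :=
  PolySuper.map LinearMap.id
    (CliffordAlgebra.involute (Q := (0 : QuadraticForm ℂ (Fin d × Fin n → ℂ)))).toLinearMap

/-- `E_{pq} = ∑_j z_p^j ∂/∂z_q^j ± (d/2) δ_{pq}`, where `z` stands for `x` or `η` and the sign is
`+` for even and `-` for odd indices. -/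
def opE (p q : Idx m n) : Module.End ℂ (PolySuper d m n) :=
  ∑ j, mulOp j p * diffOp j q + (if p = q then sg (par p) * ((d : ℂ) / 2) else 0) • 1

/-- `I_{pq} = ∑_j s_j z_p^j z_q^{d+1-j}`. -/
def opI (s : Fin d → ℂ) (p q : Idx m n) : Module.End ℂ (PolySuper d m n) :=
  ∑ j, s j • (mulOp j p * mulOp j.rev q)

/-- `Δ_{pq} = ∑_j s_j ∂/∂z_p^j ∂/∂z_q^{d+1-j}`. -/
def opDelta (s : Fin d → ℂ) (p q : Idx m n) : Module.End ℂ (PolySuper d m n) :=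
  ∑ j, s j • (diffOp j p * diffOp j.rev q)

/-- The matrix `X`, with blocks `A : e_q ↦ e_p`, `B : e_q* ↦ e_p`, `C : e_q ↦ e_p*`, acts by
`∑ A_{pq} E_{pq} + 1/2 ∑ B_{pq} I_{pq} - τ/2 ∑ (-1)^{deg p} C_{pq} Δ_{pq}`; for `X` preserving
`superForm m n τ` the fourth block is determined by `A`. -/
def rho (τ : ℂ) (s : Fin d → ℂ) :
    Matrix (DIdx m n) (DIdx m n) ℂ →ₗ[ℂ] Module.End ℂ (PolySuper d m n) where
  toFun X := ∑ p, ∑ q, (X (Sum.inl p) (Sum.inl q) • opE p q +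
    (1 / 2 * X (Sum.inl p) (Sum.inr q)) • opI s p q -
    (τ / 2 * sg (par p) * X (Sum.inr p) (Sum.inl q)) • opDelta s p q)
  map_add' X Y := by
    simp only [← Finset.sum_add_distrib]
    refine Finset.sum_congr rfl fun p _ => Finset.sum_congr rfl fun q _ => ?_
    simp only [Matrix.add_apply]
    module
  map_smul' c X := by
    simp only [Finset.smul_sum]
    refine Finset.sum_congr rfl fun p _ => Finset.sum_congr rfl fun q _ => ?_
    simp only [Matrix.smul_apply, smul_eq_mul, RingHom.id_apply]
    module

theorem pderiv_pderiv {σ : Type*} (i j : σ) (f : MvPolynomial σ ℂ) :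
    MvPolynomial.pderiv i (MvPolynomial.pderiv j f) =
      MvPolynomial.pderiv j (MvPolynomial.pderiv i f) := by
  classical
  have h : ⁅MvPolynomial.pderiv (R := ℂ) i, MvPolynomial.pderiv (R := ℂ) j⁆ = 0 := by
    refine MvPolynomial.derivation_ext fun k => ?_
    rw [Derivation.commutator_apply, MvPolynomial.pderiv_X, MvPolynomial.pderiv_X]
    simp only [Pi.single_apply]
    split_ifs <;> simp
  have h' := congrArg (fun D : Derivation ℂ (MvPolynomial σ ℂ) (MvPolynomial σ ℂ) => D f) h
  simpa [Derivation.commutator_apply, sub_eq_zero] using h'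

theorem PolySuper.map_mk (S : Module.End ℂ (MvPolynomial (Fin d × Fin m) ℂ))
    (T : Module.End ℂ (ExteriorAlgebra ℂ (Fin d × Fin n → ℂ)))
    (f : MvPolynomial (Fin d × Fin m) ℂ) (w : ExteriorAlgebra ℂ (Fin d × Fin n → ℂ)) :
    PolySuper.map S T (PolySuper.mk f w) = PolySuper.mk (S f) (T w) := rfl

theorem PolySuper.mk_add_left (f g : MvPolynomial (Fin d × Fin m) ℂ)
    (w : ExteriorAlgebra ℂ (Fin d × Fin n → ℂ)) :
    PolySuper.mk (f + g) w = PolySuper.mk f w + PolySuper.mk g w := TensorProduct.add_tmul _ _ _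

theorem PolySuper.mk_add_right (f : MvPolynomial (Fin d × Fin m) ℂ)
    (v w : ExteriorAlgebra ℂ (Fin d × Fin n → ℂ)) :
    PolySuper.mk f (v + w) = PolySuper.mk f v + PolySuper.mk f w := TensorProduct.tmul_add _ _ _

theorem PolySuper.mk_smul_left (c : ℂ) (f : MvPolynomial (Fin d × Fin m) ℂ)
    (w : ExteriorAlgebra ℂ (Fin d × Fin n → ℂ)) :
    PolySuper.mk (c • f) w = c • PolySuper.mk f w := rfl

theorem PolySuper.mk_smul_right (c : ℂ) (f : MvPolynomial (Fin d × Fin m) ℂ)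
    (w : ExteriorAlgebra ℂ (Fin d × Fin n → ℂ)) :
    PolySuper.mk f (c • w) = c • PolySuper.mk f w := TensorProduct.tmul_smul _ _ _

theorem PolySuper.end_ext {S T : Module.End ℂ (PolySuper d m n)}
    (h : ∀ f w, S (PolySuper.mk f w) = T (PolySuper.mk f w)) : S = T :=
  TensorProduct.ext' h

theorem mulOp_mulOp (j l : Fin d) (p q : Idx m n) :
    mulOp j p * mulOp l q = sg (par p * par q) • (mulOp l q * mulOp j p) := by
  refine PolySuper.end_ext fun f w => ?_
  rcases p with i | k <;> rcases q with i' | k' <;>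
    simp only [mulOp, par, Module.End.mul_apply, PolySuper.map_mk, LinearMap.id_apply,
      LinearMap.mulLeft_apply, Sum.elim_inl, Sum.elim_inr, mul_one, mul_zero, sg_zero,
      sg_one, LinearMap.smul_apply, one_smul]
  · rw [mul_left_comm]
  · rw [← PolySuper.mk_smul_right, neg_one_smul, ← mul_assoc, ← mul_assoc, ← neg_mul,
      eq_neg_of_add_eq_zero_left (ExteriorAlgebra.ι_add_mul_swap _ _)]

theorem diffOp_diffOp (j l : Fin d) (p q : Idx m n) :
    diffOp j p * diffOp l q = sg (par p * par q) • (diffOp l q * diffOp j p) := by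
  refine PolySuper.end_ext fun f w => ?_
  rcases p with i | k <;> rcases q with i' | k' <;>
    simp only [diffOp, par, Module.End.mul_apply, PolySuper.map_mk, LinearMap.id_apply,
      Derivation.coeFn_coe, Sum.elim_inl, Sum.elim_inr, mul_one, mul_zero, sg_zero,
      sg_one, LinearMap.smul_apply, one_smul]
  · rw [pderiv_pderiv]
  · rw [← PolySuper.mk_smul_right, neg_one_smul, CliffordAlgebra.contractLeft_comm]

theorem diffOp_mulOp (j l : Fin d) (p q : Idx m n) :
    diffOp j p * mulOp l q = sg (par p * par q) • (mulOp l q * diffOp j p) +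
      (if j = l ∧ p = q then (1 : ℂ) else 0) • 1 := by
  refine PolySuper.end_ext fun f w => ?_
  rcases p with i | k <;> rcases q with i' | k' <;>
    simp only [diffOp, mulOp, par, Module.End.mul_apply, PolySuper.map_mk, LinearMap.id_apply,
      Derivation.coeFn_coe, Sum.elim_inl, Sum.elim_inr, mul_one, mul_zero, sg_zero,
      sg_one, LinearMap.smul_apply, one_smul, LinearMap.mulLeft_apply, LinearMap.add_apply,
      Module.End.one_apply, reduceCtorEq, and_false, if_false, zero_smul, add_zero,
      Sum.inl.injEq, Sum.inr.injEq]
  · rw [Derivation.leibniz, PolySuper.mk_add_left, smul_eq_mul, smul_eq_mul]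
    congr 1
    by_cases h : j = l ∧ i = i'
    · obtain ⟨rfl, rfl⟩ := h
      simp
    · rw [MvPolynomial.pderiv_X_of_ne, if_neg h, mul_zero, zero_smul,
        ← zero_smul ℂ (0 : MvPolynomial (Fin d × Fin m) ℂ), PolySuper.mk_smul_left, zero_smul]
      rintro h'
      exact h ⟨(congrArg Prod.fst h').symm, (congrArg Prod.snd h').symm⟩
  · rw [← PolySuper.mk_smul_right, ← PolySuper.mk_smul_right, ← PolySuper.mk_add_right,
      ExteriorAlgebra.ι, CliffordAlgebra.contractLeft_ι_mul, neg_one_smul, sub_eq_neg_add]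
    congr 3
    by_cases h : j = l ∧ k = k'
    · obtain ⟨rfl, rfl⟩ := h
      simp
    · rw [if_neg h, LinearMap.proj_apply, Pi.single_eq_of_ne]
      rintro h'
      exact h ⟨congrArg Prod.fst h', congrArg Prod.snd h'⟩

theorem involute_contract {M : Type*} [AddCommGroup M] [Module ℂ M] (δ : Module.Dual ℂ M)
    (w : CliffordAlgebra (0 : QuadraticForm ℂ M)) :
    CliffordAlgebra.involute (CliffordAlgebra.contractLeft δ w) =
      -CliffordAlgebra.contractLeft δ (CliffordAlgebra.involute w) := by
  induction w using CliffordAlgebra.left_induction with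
  | algebraMap r => simp
  | add x y hx hy => simp only [map_add, hx, hy, neg_add]
  | ι_mul x v hx =>
    simp only [CliffordAlgebra.contractLeft_ι_mul, map_sub, map_smul, map_mul,
      CliffordAlgebra.involute_ι, hx, neg_mul, map_neg, CliffordAlgebra.contractLeft_ι_mul]
    simp

theorem parityOp_parityOp : parityOp * parityOp = (1 : Module.End ℂ (PolySuper d m n)) := by
  refine PolySuper.end_ext fun f w => ?_
  simp only [parityOp, Module.End.mul_apply, PolySuper.map_mk, LinearMap.id_apply,
    AlgHom.toLinearMap_apply, CliffordAlgebra.involute_involute, Module.End.one_apply]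

theorem parityOp_mulOp (j : Fin d) (p : Idx m n) :
    parityOp * mulOp j p = sg (par p) • (mulOp j p * parityOp) := by
  refine PolySuper.end_ext fun f w => ?_
  rcases p with i | k <;>
    simp only [parityOp, mulOp, par, Module.End.mul_apply, PolySuper.map_mk, LinearMap.id_apply,
      Sum.elim_inl, Sum.elim_inr, sg_one, sg_zero, LinearMap.mulLeft_apply, LinearMap.smul_apply,
      AlgHom.toLinearMap_apply, one_smul]
  rw [map_mul, ExteriorAlgebra.ι, CliffordAlgebra.involute_ι, ← PolySuper.mk_smul_right,
    neg_one_smul, neg_mul]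

theorem parityOp_diffOp (j : Fin d) (p : Idx m n) :
    parityOp * diffOp j p = sg (par p) • (diffOp j p * parityOp) := by
  refine PolySuper.end_ext fun f w => ?_
  rcases p with i | k <;>
    simp only [parityOp, diffOp, par, Module.End.mul_apply, PolySuper.map_mk, LinearMap.id_apply,
      Sum.elim_inl, Sum.elim_inr, sg_one, sg_zero, LinearMap.smul_apply,
      AlgHom.toLinearMap_apply, one_smul]
  rw [involute_contract, ← PolySuper.mk_smul_right, neg_one_smul]

theorem mulOp_diffOp (j l : Fin d) (p q : Idx m n) :
    mulOp j p * diffOp l q = sg (par p * par q) • (diffOp l q * mulOp j p) +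
      (if l = j ∧ p = q then -sg (par p) else 0) • 1 := by
  rw [diffOp_mulOp, smul_add, smul_smul, mul_comm (par q), sg_mul_self, one_smul, add_assoc,
    smul_smul, ← add_smul]
  by_cases h : l = j ∧ p = q
  · obtain ⟨rfl, rfl⟩ := h
    simp [zmod_two_mul_self]
  · have h' : ¬ (l = j ∧ q = p) := fun h' => h ⟨h'.1, h'.2.symm⟩
    simp [h, h']

/-- The generators `z_p^j` and `-(-1)^{deg p} s_j ∂/∂z_p^{d+1-j}`, attached to the basis vectors
`e_p` and `e_p*`. -/
def genOp (s : Fin d → ℂ) (j : Fin d) : DIdx m n → Module.End ℂ (PolySuper d m n)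
  | Sum.inl p => mulOp j p
  | Sum.inr p => (-sg (par p) * s j) • diffOp j.rev p

theorem genOp_genOp {τ : ℂ} {s : Fin d → ℂ} (hr : ∀ j, s (Fin.rev j) = τ * s j)
    (j l : Fin d) (a b : DIdx m n) :
    genOp s j a * genOp s l b = sg (dpar a * dpar b) • (genOp s l b * genOp s j a) +
      (superForm m n τ a b * (if l = j.rev then τ * s j else 0)) • 1 := by
  have hrev : (j.rev = l) ↔ l = j.rev := eq_comm
  have hrev' : (l.rev = j) ↔ l = j.rev := by
    constructor
    · rintro rfl; simp
    · rintro rfl; simp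
  rcases a with p | p <;> rcases b with q | q
  · simp [genOp, dpar, superForm, mulOp_mulOp j l p q]
  · simp only [genOp, dpar, Sum.elim_inl, Sum.elim_inr, mul_smul_comm, smul_mul_assoc]
    rw [mulOp_diffOp, smul_add, smul_smul, smul_smul, smul_smul, mul_comm (sg (par p * par q))]
    congr 2
    simp only [superForm, Matrix.fromBlocks_apply₁₂, Matrix.one_apply, hrev']
    by_cases hl : l = j.rev <;> by_cases hp : p = q
    · subst hl; subst hp
      simp only [and_self, if_true, hr]
      linear_combination τ * s j * sg_mul_self (par p)
    all_goals simp [hl, hp]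
  · simp only [genOp, dpar, Sum.elim_inl, Sum.elim_inr, mul_smul_comm, smul_mul_assoc]
    rw [diffOp_mulOp, smul_add, smul_smul, smul_smul, smul_smul, mul_comm (sg (par p * par q))]
    congr 2
    simp only [superForm, Matrix.fromBlocks_apply₂₁, Matrix.diagonal_apply, hrev]
    by_cases hl : l = j.rev <;> by_cases hp : p = q
    · subst hl; subst hp
      have h1 := hr j.rev
      rw [Fin.rev_rev, hr] at h1
      simp only [and_self, if_true]
      linear_combination -sg (par p) * h1
    all_goals simp [hl, hp]
  · simp only [genOp, dpar, Sum.elim_inr, mul_smul_comm, smul_mul_assoc]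
    rw [diffOp_diffOp]
    simp only [superForm, Matrix.fromBlocks_apply₂₂, Matrix.zero_apply, zero_mul, zero_smul,
      add_zero]
    module

/-- The quadratic element `1/2 ∑ N_{ba} s_j Z_b^j Z_a^{d+1-j}` in the generators `Z = genOp`. -/
def quad (s : Fin d → ℂ) (N : Matrix (DIdx m n) (DIdx m n) ℂ) :
    Module.End ℂ (PolySuper d m n) :=
  ∑ j, ∑ b, ∑ a, (1 / 2 * N b a * s j) • (genOp s j b * genOp s j.rev a)

/-- The inverse of `superForm m n τ`. -/
def formInv (m n : ℕ) (τ : ℂ) : Matrix (DIdx m n) (DIdx m n) ℂ :=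
  Matrix.fromBlocks 0 (Matrix.diagonal fun p => -τ * sg (par p)) 1 0

theorem formInv_mul {τ : ℂ} (hτ : τ * τ = 1) : formInv m n τ * superForm m n τ = 1 := by
  have h : ∀ p : Idx m n, τ * sg (par p) * (τ * sg (par p)) = 1 := fun p => by
    linear_combination hτ * (sg (par p) * sg (par p)) + sg_mul_self (par p)
  simp [formInv, superForm, Matrix.fromBlocks_multiply, h]

theorem superForm_mul {τ : ℂ} (hτ : τ * τ = 1) : superForm m n τ * formInv m n τ = 1 :=
  mul_eq_one_comm.1 (formInv_mul hτ)

/-- On the matrices preserving the form, `rho` is given by the quadratic elements `quad`. -/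
theorem rho_eq_quad {τ : ℂ} (hτ : τ * τ = 1) {s : Fin d → ℂ} (hs : ∀ j, s j * s j = 1)
    (hr : ∀ j, s (Fin.rev j) = τ * s j) {X : Matrix (DIdx m n) (DIdx m n) ℂ}
    (hX : X ∈ ortho dpar (superForm m n τ)) : rho τ s X = quad s (X * formInv m n τ) := by
  have e1 : ∀ p : DIdx m n, ∀ q, (X * formInv m n τ) p (Sum.inl q) = X p (Sum.inr q) := by
    intro p q
    rw [Matrix.mul_apply, Fintype.sum_sum_type]
    simp [formInv, Matrix.one_apply]
  have e2 : ∀ p : DIdx m n, ∀ q, (X * formInv m n τ) p (Sum.inr q) =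
      X p (Sum.inl q) * (-τ * sg (par q)) := by
    intro p q
    rw [Matrix.mul_apply, Fintype.sum_sum_type]
    simp [formInv, Matrix.diagonal_apply]
  have e3 : ∀ p q : Idx m n, X (Sum.inr p) (Sum.inr q) =
      -sg (par p + par p * par q) * X (Sum.inl q) (Sum.inl p) := by
    intro p q
    have h := (mem_ortho_superForm (comp_comp_self (par p + par q) X)).1
      (comp_mem_ortho hX _) (Sum.inl p) (Sum.inr q)
    have h1 : par q + par p = par p + par q := add_comm _ _
    simp only [Sum.swap_inl, Sum.swap_inr, formCoeff, Sum.elim_inl, comp_apply, dpar,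
      Sum.elim_inr, h1, if_true, mul_one, one_mul] at h
    have h2 : (par p + par q) * par p = par p + par p * par q := by
      rw [add_mul, zmod_two_mul_self, mul_comm (par q)]
    rw [h2] at h
    have h3 := sg_mul_self (par p + par p * par q)
    linear_combination sg (par p + par p * par q) * h - X (Sum.inr p) (Sum.inr q) * h3
  have hA : ∀ p q : Idx m n, ∑ j, (1 / 2 * (X (Sum.inl p) (Sum.inl q) * (-τ * sg (par q))) * s j) •
      (genOp s j (Sum.inl p) * genOp s j.rev (Sum.inr q)) =
      (1 / 2 * X (Sum.inl p) (Sum.inl q)) • ∑ j, mulOp j p * diffOp j q := by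
    intro p q
    rw [Finset.smul_sum]
    refine Finset.sum_congr rfl fun j _ => ?_
    simp only [genOp, Fin.rev_rev, mul_smul_comm, smul_smul, hr]
    congr 1
    have h1 := sg_mul_self (par q)
    linear_combination (1 / 2 * X (Sum.inl p) (Sum.inl q)) *
      (s j * s j * sg (par q) * sg (par q) * hτ + sg (par q) * sg (par q) * hs j + h1)
  have hD : ∀ p q : Idx m n, ∑ j, (1 / 2 * X (Sum.inr p) (Sum.inr q) * s j) •
      (genOp s j (Sum.inr p) * genOp s j.rev (Sum.inl q)) =
      (1 / 2 * X (Sum.inl q) (Sum.inl p)) • ∑ j, mulOp j q * diffOp j p +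
      (1 / 2 * X (Sum.inl q) (Sum.inl p)) • ((if q = p then sg (par p) * d else 0) •
        (1 : Module.End ℂ (PolySuper d m n))) := by
    intro p q
    rw [← Equiv.sum_comp Fin.revPerm]
    have : ∀ j : Fin d, (1 / 2 * X (Sum.inr p) (Sum.inr q) * s (Fin.revPerm j)) •
      (genOp s (Fin.revPerm j) (Sum.inr p) * genOp s (Fin.revPerm j).rev (Sum.inl q)) =
      (1 / 2 * X (Sum.inl q) (Sum.inl p)) • (mulOp j q * diffOp j p) +
      (1 / 2 * X (Sum.inl q) (Sum.inl p)) • ((if q = p then sg (par p) else 0) • 1) := by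
      intro j
      have h0 := hs j
      have h1 := sg_mul_self (par p)
      have h2 := sg_mul_self (par p * par q)
      simp only [genOp, Fin.revPerm_apply, Fin.rev_rev, smul_mul_assoc, hr, e3, sg_add]
      rw [diffOp_mulOp, smul_add, smul_add]
      simp only [smul_smul]
      congr 2
      · linear_combination (1 / 2 * X (Sum.inl q) (Sum.inl p)) *
          (hτ * (s j * s j * sg (par p) * sg (par p) * sg (par p * par q) * sg (par p * par q))
          + h0 * (sg (par p) * sg (par p) * sg (par p * par q) * sg (par p * par q)) +
          h1 * (sg (par p * par q) * sg (par p * par q)) + h2)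
      · by_cases h : q = p
        · subst h
          simp only [zmod_two_mul_self, and_self, if_true]
          linear_combination (1 / 2 * X (Sum.inl q) (Sum.inl q)) *
            (hτ * (s j * s j * sg (par q) * sg (par q) * sg (par q))
            + h0 * (sg (par q) * sg (par q) * sg (par q)) + h1 * sg (par q))
        · have h' : ¬ p = q := fun h' => h h'.symm
          simp [h, h']
    rw [Finset.sum_congr rfl fun j _ => this j, Finset.sum_add_distrib, ← Finset.smul_sum]
    congr 1
    rw [Finset.sum_const, Finset.card_univ, Fintype.card_fin, ← Nat.cast_smul_eq_nsmul ℂ]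
    split_ifs <;> module
  have hC : ∀ p q : Idx m n, ∑ j, (1 / 2 * (X (Sum.inr p) (Sum.inl q) * (-τ * sg (par q))) * s j) •
      (genOp s j (Sum.inr p) * genOp s j.rev (Sum.inr q)) =
      (-(τ / 2 * sg (par p) * X (Sum.inr p) (Sum.inl q))) • opDelta s p q := by
    intro p q
    rw [← Equiv.sum_comp Fin.revPerm, opDelta, Finset.smul_sum]
    refine Finset.sum_congr rfl fun j _ => ?_
    simp only [genOp, Fin.revPerm_apply, Fin.rev_rev, mul_smul_comm, smul_mul_assoc, smul_smul, hr]
    congr 1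
    have h0 := hs j
    have h1 := sg_mul_self (par q)
    have h2 := sg_mul_self (par p)
    linear_combination (-1 / 2 * X (Sum.inr p) (Sum.inl q) * τ * sg (par p) * s j) *
      (hτ * (s j * s j * sg (par q) * sg (par q)) + h0 * (sg (par q) * sg (par q)) + h1)
  have hB : ∀ p q : Idx m n, ∑ j, (1 / 2 * X (Sum.inl p) (Sum.inr q) * s j) •
      (genOp s j (Sum.inl p) * genOp s j.rev (Sum.inl q)) =
      (1 / 2 * X (Sum.inl p) (Sum.inr q)) • opI s p q := by
    intro p q
    rw [opI, Finset.smul_sum]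
    refine Finset.sum_congr rfl fun j _ => ?_
    rw [smul_smul]; rfl
  have hq : quad s (X * formInv m n τ) = ∑ b, ∑ a, ∑ j,
      (1 / 2 * (X * formInv m n τ) b a * s j) • (genOp s j b * genOp s j.rev a) := by
    rw [quad, Finset.sum_comm]
    exact Finset.sum_congr rfl fun b _ => Finset.sum_comm
  have hsplit : ∀ f : DIdx m n → DIdx m n → Module.End ℂ (PolySuper d m n),
      ∑ b, ∑ a, f b a = (∑ p, ∑ q, f (Sum.inl p) (Sum.inl q) +
        ∑ p, ∑ q, f (Sum.inl p) (Sum.inr q)) + (∑ p, ∑ q, f (Sum.inr p) (Sum.inl q) +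
        ∑ p, ∑ q, f (Sum.inr p) (Sum.inr q)) := by
    intro f
    have h : ∀ b, ∑ a, f b a = ∑ q, f b (Sum.inl q) + ∑ q, f b (Sum.inr q) :=
      fun b => Fintype.sum_sum_type _
    rw [Fintype.sum_sum_type]
    simp only [h, Finset.sum_add_distrib]
  rw [hq, hsplit]
  simp only [e1, e2, hA, hB, hC, hD, Finset.sum_add_distrib]
  have hcomm : ∀ f : Idx m n → Idx m n → Module.End ℂ (PolySuper d m n),
      ∑ p, ∑ q, f q p = ∑ p, ∑ q, f p q := fun f => Finset.sum_comm
  rw [hcomm fun q p => (1 / 2 * X (Sum.inl q) (Sum.inl p)) • ∑ j, mulOp j q * diffOp j p,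
    hcomm fun q p => (1 / 2 * X (Sum.inl q) (Sum.inl p)) •
      ((if q = p then sg (par p) * (d : ℂ) else 0) • (1 : Module.End ℂ (PolySuper d m n)))]
  simp only [← Finset.sum_add_distrib]
  rw [rho, LinearMap.coe_mk, AddHom.coe_mk]
  refine Finset.sum_congr rfl fun p _ => Finset.sum_congr rfl fun q _ => ?_
  rw [opE]
  split_ifs with h
  · subst h; module
  · module

theorem quad_sub (s : Fin d → ℂ) (N N' : Matrix (DIdx m n) (DIdx m n) ℂ) (c : ℂ) :
    quad s (N - c • N') = quad s N - c • quad s N' := by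
  rw [quad, quad, quad]
  simp only [Finset.smul_sum, ← Finset.sum_sub_distrib]
  refine Finset.sum_congr rfl fun j _ => Finset.sum_congr rfl fun b _ =>
    Finset.sum_congr rfl fun a _ => ?_
  simp only [Matrix.sub_apply, Matrix.smul_apply, smul_eq_mul]
  module

theorem quad_add (s : Fin d → ℂ) (N N' : Matrix (DIdx m n) (DIdx m n) ℂ) :
    quad s (N + N') = quad s N + quad s N' := by
  have := quad_sub s N N' (-1)
  simpa using this

theorem formInv_mul_transpose {τ : ℂ} (hτ : τ * τ = 1) {x : ZMod 2}
    {X : Matrix (DIdx m n) (DIdx m n) ℂ} (hx : comp dpar x X = X)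
    (hX : X ∈ ortho dpar (superForm m n τ)) : formInv m n τ * X.transpose =
      -(Matrix.diagonal (fun i => sg (x * dpar i)) * X * formInv m n τ) := by
  have hc : formInv m n τ * Matrix.diagonal (fun i => sg (x * dpar i)) =
      Matrix.diagonal (fun i => sg (x * dpar i)) * formInv m n τ := by
    ext i j
    rw [Matrix.mul_diagonal, Matrix.diagonal_mul]
    rcases i with p | p <;> rcases j with q | q <;>
      simp only [formInv, Matrix.fromBlocks_apply₁₁, Matrix.fromBlocks_apply₁₂,
        Matrix.fromBlocks_apply₂₁, Matrix.fromBlocks_apply₂₂, Matrix.zero_apply, zero_mul,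
        mul_zero, Matrix.diagonal_apply, Matrix.one_apply] <;>
      split_ifs with h <;> simp [dpar, h, mul_comm]
  have h1 := (mem_ortho_of_homog hx).1 hX
  have h2 : formInv m n τ * (X.transpose * superForm m n τ) * formInv m n τ =
      formInv m n τ * X.transpose := by
    rw [← Matrix.mul_assoc, Matrix.mul_assoc _ (superForm m n τ), superForm_mul hτ,
      Matrix.mul_one]
  rw [← h2, h1, Matrix.mul_neg, Matrix.neg_mul, ← Matrix.mul_assoc, ← Matrix.mul_assoc, hc,
    Matrix.mul_assoc _ (formInv m n τ), formInv_mul hτ, Matrix.mul_one]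

theorem comp_mul_formInv {τ : ℂ} {y : ZMod 2} {Y : Matrix (DIdx m n) (DIdx m n) ℂ}
    (hy : comp dpar y Y = Y) : comp dpar y (Y * formInv m n τ) = Y * formInv m n τ := by
  have : comp dpar 0 (formInv m n τ) = formInv m n τ := by
    ext i j
    rw [comp_apply]
    split_ifs with h
    · rfl
    · rcases i with p | p <;> rcases j with q | q <;>
        simp only [formInv, Matrix.fromBlocks_apply₁₁, Matrix.fromBlocks_apply₁₂,
          Matrix.fromBlocks_apply₂₁, Matrix.fromBlocks_apply₂₂, Matrix.zero_apply,
          Matrix.diagonal_apply, Matrix.one_apply] <;>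
        split_ifs with h'
      all_goals first
        | rfl
        | (subst h'; exact absurd (CharTwo.add_self_eq_zero _) h)
  simpa using comp_mul hy this

theorem formInv_apply (τ : ℂ) (i j : DIdx m n) :
    formInv m n τ i j = if i = j.swap then formCoeff τ j else 0 := by
  rcases i with p | p <;> rcases j with q | q <;>
    simp only [formInv, formCoeff, Matrix.fromBlocks_apply₁₁, Matrix.fromBlocks_apply₁₂,
      Matrix.fromBlocks_apply₂₁, Matrix.fromBlocks_apply₂₂, Matrix.zero_apply, Sum.swap_inl,
      Sum.swap_inr, reduceCtorEq, if_false, Sum.inl.injEq, Sum.inr.injEq, Sum.elim_inl,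
      Sum.elim_inr, Matrix.one_apply, Matrix.diagonal_apply]
  split_ifs with h
  · rw [h]
  · rfl

/-- The elements of the Lie superalgebra act on the generators as on the basis vectors. -/
theorem quad_genOp {τ : ℂ} (hτ : τ * τ = 1) {s : Fin d → ℂ} (hs : ∀ j, s j * s j = 1)
    (hr : ∀ j, s (Fin.rev j) = τ * s j) {x : ZMod 2} {X : Matrix (DIdx m n) (DIdx m n) ℂ}
    (hx : comp dpar x X = X) (hX : X ∈ ortho dpar (superForm m n τ)) (l : Fin d) (c : DIdx m n) :
    quad s (X * formInv m n τ) * genOp s l c =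
      sg (x * dpar c) • (genOp s l c * quad s (X * formInv m n τ)) + ∑ b, X b c • genOp s l b := by
  have hN := comp_mul_formInv (τ := τ) hx
  have m3 : ∀ b, ∑ a, (X * formInv m n τ) b a * superForm m n τ a c = X b c := by
    intro b
    rw [← Matrix.mul_apply, Matrix.mul_assoc, formInv_mul hτ, Matrix.mul_one]
  have m2 : ∀ a, τ * sg (dpar a * dpar c) *
      ∑ b, (X * formInv m n τ) b a * superForm m n τ b c = X a c := by
    intro a
    have h1 := (mem_ortho_superForm hx).1 hX a.swap c
    rw [Sum.swap_swap, dpar_swap] at h1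
    rw [Finset.sum_eq_single c.swap]
    · rw [superForm_apply, if_pos (Sum.swap_swap c).symm, Matrix.mul_apply,
        Finset.sum_eq_single a.swap]
      · rw [formInv_apply, if_pos rfl]
        by_cases h : dpar a + dpar c = x
        · have e : sg (x * dpar a) = sg (dpar a) * sg (dpar a * dpar c) := by
            rw [← h, add_mul, zmod_two_mul_self, sg_add, mul_comm (dpar c)]
          rw [e] at h1
          have h2 := formCoeff_swap (τ := τ) a
          have s1 := sg_mul_self (dpar a)
          have s2 := sg_mul_self (dpar a * dpar c)
          generalize sg (dpar a) = u at *
          generalize sg (dpar a * dpar c) = v at *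
          generalize formCoeff τ a = w at *
          generalize formCoeff τ a.swap = w' at *
          linear_combination τ * v * w * h1 - τ * v * u * v * X a c * h2 +
            (u * u * v * v * X a c) * hτ + (v * v * X a c) * s1 + X a c * s2
        · have z : ∀ i j, dpar i = dpar c → dpar j = dpar a → X i j = 0 := by
            intro i j hi hj
            rw [← hx, comp_apply, if_neg (by rw [hi, hj, add_comm]; exact h)]
          have z' : X a c = 0 := by rw [← hx, comp_apply, if_neg h]
          rw [z c.swap a.swap (dpar_swap c) (dpar_swap a), z']
          ring
      · intro i _ hi
        rw [formInv_apply, if_neg hi, mul_zero]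
      · simp
    · intro b _ hb
      rw [superForm_apply, if_neg, mul_zero]
      rintro rfl
      exact hb (Sum.swap_swap b).symm
    · simp
  generalize X * formInv m n τ = N at hN m2 m3
  have h1 : ∀ j b a, ((1 / 2 * N b a * s j) • (genOp s j b * genOp s j.rev a)) * genOp s l c =
      sg (x * dpar c) • (genOp s l c * ((1 / 2 * N b a * s j) •
        (genOp s j b * genOp s j.rev a))) +
      ((if l = j.rev then (1 / 2 * (τ * sg (dpar a * dpar c) * (N b a * superForm m n τ b c))) •
        genOp s l a else 0) +
      (if l = j then (1 / 2 * (N b a * superForm m n τ a c)) • genOp s l b else 0)) := by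
    intro j b a
    by_cases h : dpar b + dpar a = x
    · have e : sg (x * dpar c) = sg (dpar b * dpar c) * sg (dpar a * dpar c) := by
        rw [← h, add_mul, sg_add]
      rw [smul_mul_assoc, mul_assoc (genOp s j b), genOp_genOp hr j.rev l a c, Fin.rev_rev,
        mul_add, mul_smul_comm, mul_smul_comm, mul_one, ← mul_assoc (genOp s j b),
        genOp_genOp hr j l b c, add_mul, smul_mul_assoc,
        smul_mul_assoc, one_mul, mul_smul_comm, ← mul_assoc (genOp s l c), e, hr]
      have h0 := hs j
      have hA : ∀ t : ℂ, (if l = j.rev then t • genOp s l a else 0) =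
          (if l = j.rev then t else 0) • genOp s j.rev a := by
        intro t
        split_ifs with h'
        · rw [h']
        · rw [zero_smul]
      have hB : ∀ t : ℂ, (if l = j then t • genOp s l b else 0) =
          (if l = j then t else 0) • genOp s j b := by
        intro t
        split_ifs with h'
        · rw [h']
        · rw [zero_smul]
      rw [hA, hB]
      match_scalars
      · ring
      · split_ifs
        · linear_combination (1 / 2 * N b a * sg (dpar a * dpar c) * superForm m n τ b c * τ) * h0
        · ring
      · split_ifs
        · linear_combination (1 / 2 * N b a * superForm m n τ a c) * (hτ * (s j * s j) + h0)
        · ring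
    · have z : N b a = 0 := by rw [← hN, comp_apply, if_neg h]
      simp [z]
  have h2 : ∑ j : Fin d, ∑ b, ∑ a, (if l = j.rev then
      (1 / 2 * (τ * sg (dpar a * dpar c) * (N b a * superForm m n τ b c))) • genOp s l a else 0) =
      (1 / 2 : ℂ) • ∑ b, X b c • genOp s l b := by
    rw [Finset.sum_eq_single l.rev]
    · simp only [Fin.rev_rev, if_true]
      rw [Finset.sum_comm, Finset.smul_sum]
      refine Finset.sum_congr rfl fun a _ => ?_
      rw [← Finset.sum_smul, ← Finset.mul_sum, ← Finset.mul_sum, m2, smul_smul]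
    · intro j _ hj
      have : ¬ l = j.rev := by
        rintro rfl
        exact hj (Fin.rev_rev j).symm
      simp only [if_neg this, Finset.sum_const_zero]
    · simp
  have h3 : ∑ j : Fin d, ∑ b, ∑ a, (if l = j then
      (1 / 2 * (N b a * superForm m n τ a c)) • genOp s l b else 0) =
      (1 / 2 : ℂ) • ∑ b, X b c • genOp s l b := by
    rw [Finset.sum_eq_single l]
    · simp only [if_true]
      rw [Finset.smul_sum]
      refine Finset.sum_congr rfl fun b _ => ?_
      rw [← Finset.sum_smul, ← Finset.mul_sum, m3, smul_smul]
    · intro j _ hj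
      simp only [if_neg (Ne.symm hj), Finset.sum_const_zero]
    · simp
  rw [quad]
  simp only [Finset.mul_sum, Finset.sum_mul, Finset.smul_sum (r := sg (x * dpar c)), h1,
    Finset.sum_add_distrib]
  rw [h2, h3]
  module

theorem mul_quad {s : Fin d → ℂ} {x y : ZMod 2} {X N : Matrix (DIdx m n) (DIdx m n) ℂ}
    (hN : comp dpar y N = N) (R : Module.End ℂ (PolySuper d m n))
    (hR : ∀ l c, R * genOp s l c = sg (x * dpar c) • (genOp s l c * R) + ∑ b, X b c • genOp s l b) :
    R * quad s N = sg (x * y) • (quad s N * R) +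
      quad s (X * N + Matrix.diagonal (fun i => sg (x * dpar i)) * N * X.transpose) := by
  have h1 : ∀ j b a, R * ((1 / 2 * N b a * s j) • (genOp s j b * genOp s j.rev a)) =
      sg (x * y) • (((1 / 2 * N b a * s j) • (genOp s j b * genOp s j.rev a)) * R) +
      (∑ c, (1 / 2 * (X c b * N b a) * s j) • (genOp s j c * genOp s j.rev a) +
      ∑ c, (1 / 2 * (sg (x * dpar b) * N b a * X c a) * s j) •
        (genOp s j b * genOp s j.rev c)) := by
    intro j b a
    rw [mul_smul_comm, ← mul_assoc R, hR, add_mul, smul_mul_assoc, mul_assoc (genOp s j b), hR,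
      mul_add,
      Finset.sum_mul, Finset.mul_sum]
    simp only [smul_add, Finset.smul_sum, smul_mul_assoc, mul_smul_comm, smul_smul, mul_assoc]
    by_cases h : dpar b + dpar a = y
    · have e : sg (x * y) = sg (x * dpar b) * sg (x * dpar a) := by rw [← h, mul_add, sg_add]
      rw [e]
      have : ∀ u v w z : Module.End ℂ (PolySuper d m n), u = w → v = z →
        ∀ t t', t = t' → t + v + u = t' + (w + z) := by
        rintro u v w z rfl rfl t t' rfl; abel
      refine this _ _ _ _ ?_ ?_ _ _ ?_
      · refine Finset.sum_congr rfl fun c _ => ?_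
        congr 1; ring
      · refine Finset.sum_congr rfl fun c _ => ?_
        congr 1; ring
      · congr 1; ring
    · have z : N b a = 0 := by rw [← hN, comp_apply, if_neg h]
      simp [z]
  have h2 : ∀ j, ∑ b, ∑ a, ∑ c, (1 / 2 * (X c b * N b a) * s j) •
      (genOp s j c * genOp s j.rev a) =
      ∑ c, ∑ a, (1 / 2 * (X * N) c a * s j) • (genOp s j c * genOp s j.rev a) := by
    intro j
    have : ∀ b, ∑ a, ∑ c, (1 / 2 * (X c b * N b a) * s j) • (genOp s j c * genOp s j.rev a) =
      ∑ c, ∑ a, (1 / 2 * (X c b * N b a) * s j) • (genOp s j c * genOp s j.rev a) :=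
      fun b => Finset.sum_comm
    rw [Finset.sum_congr rfl fun b _ => this b, Finset.sum_comm]
    refine Finset.sum_congr rfl fun c _ => ?_
    rw [Finset.sum_comm]
    refine Finset.sum_congr rfl fun a _ => ?_
    rw [← Finset.sum_smul, Matrix.mul_apply, Finset.mul_sum, Finset.sum_mul]
  have h3 : ∀ j, ∑ b, ∑ a, ∑ c, (1 / 2 * (sg (x * dpar b) * N b a * X c a) * s j) •
        (genOp s j b * genOp s j.rev c) =
      ∑ b, ∑ c, (1 / 2 * (Matrix.diagonal (fun i => sg (x * dpar i)) * N * X.transpose :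
        Matrix (DIdx m n) (DIdx m n) ℂ) b c *
        s j) • (genOp s j b * genOp s j.rev c) := by
    intro j
    refine Finset.sum_congr rfl fun b _ => ?_
    rw [Finset.sum_comm]
    refine Finset.sum_congr rfl fun c _ => ?_
    rw [← Finset.sum_smul, Matrix.mul_apply, Finset.mul_sum, Finset.sum_mul]
    simp only [Matrix.diagonal_mul, Matrix.transpose_apply]
  rw [quad_add, quad, quad, quad]
  simp only [Finset.mul_sum, Finset.sum_mul, Finset.smul_sum, h1, Finset.sum_add_distrib, h2, h3]

theorem rho_bracket {τ : ℂ} (hτ : τ * τ = 1) {s : Fin d → ℂ} (hs : ∀ j, s j * s j = 1)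
    (hr : ∀ j, s (Fin.rev j) = τ * s j) {x y : ZMod 2} {X Y : Matrix (DIdx m n) (DIdx m n) ℂ}
    (hx : comp dpar x X = X) (hX : X ∈ ortho dpar (superForm m n τ))
    (hy : comp dpar y Y = Y) (hY : Y ∈ ortho dpar (superForm m n τ)) :
    rho τ s (superBracket dpar X Y) =
      rho τ s X * rho τ s Y - sg (x * y) • (rho τ s Y * rho τ s X) := by
  have hN := comp_mul_formInv (τ := τ) hy
  rw [rho_eq_quad hτ hs hr hX, rho_eq_quad hτ hs hr hY,
    rho_eq_quad hτ hs hr (superBracket_mem_ortho hX hY),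
    mul_quad hN _ (fun l c => quad_genOp hτ hs hr hx hX l c), superBracket_of_homog hx hy]
  have hYD : Y * Matrix.diagonal (fun i => sg (x * dpar i)) =
      sg (x * y) • (Matrix.diagonal (fun i => sg (x * dpar i)) * Y) := by
    ext i j
    rw [Matrix.mul_diagonal, Matrix.smul_apply, Matrix.diagonal_mul, ← hy, comp_apply]
    split_ifs with h
    · rw [← h, mul_add, sg_add, smul_eq_mul]
      linear_combination (-sg (x * dpar j) * Y i j) * sg_mul_self (x * dpar i)
    · simp
  have hDD : Matrix.diagonal (fun i : DIdx m n => sg (x * dpar i)) *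
      Matrix.diagonal (fun i => sg (x * dpar i)) = 1 := by
    rw [Matrix.diagonal_mul_diagonal, ← Matrix.diagonal_one]
    exact congrArg _ (funext fun i => sg_mul_self _)
  rw [add_sub_cancel_left, Matrix.mul_assoc (Matrix.diagonal _), Matrix.mul_assoc Y,
    formInv_mul_transpose hτ hx hX]
  congr 1
  rw [Matrix.mul_neg, ← Matrix.mul_assoc, ← Matrix.mul_assoc, ← Matrix.mul_assoc Y, hYD,
    Matrix.mul_neg,
    Matrix.smul_mul, Matrix.smul_mul, Matrix.mul_smul, ← Matrix.mul_assoc, ← Matrix.mul_assoc,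
    ← Matrix.mul_assoc, hDD, Matrix.one_mul, Matrix.sub_mul, Matrix.smul_mul, sub_eq_add_neg]

theorem parityOp_rho {τ : ℂ} {s : Fin d → ℂ} {x : ZMod 2} {X : Matrix (DIdx m n) (DIdx m n) ℂ}
    (hx : comp dpar x X = X) : parityOp * rho τ s X = sg x • (rho τ s X * parityOp) := by
  have hq : ∀ (u v : Module.End ℂ (PolySuper d m n)) (a b : ZMod 2),
      parityOp * u = sg a • (u * parityOp) → parityOp * v = sg b • (v * parityOp) →
      parityOp * (u * v) = sg (a + b) • (u * v * parityOp) := by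
    intro u v a b hu hv
    rw [← mul_assoc, hu, smul_mul_assoc, mul_assoc, hv, mul_smul_comm, smul_smul, sg_add,
      mul_assoc]
  have hE : ∀ p q : Idx m n, parityOp * opE (d := d) p q =
      sg (par p + par q) • (opE p q * parityOp) := by
    intro p q
    rw [opE, mul_add, add_mul, smul_add, Finset.mul_sum, Finset.sum_mul, Finset.smul_sum]
    congr 1
    · exact Finset.sum_congr rfl fun j _ => hq _ _ _ _ (parityOp_mulOp j p) (parityOp_diffOp j q)
    · split_ifs with h
      · subst h
        rw [CharTwo.add_self_eq_zero, sg_zero, one_smul, mul_smul_comm, smul_mul_assoc, mul_one,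
          one_mul]
      · simp
  have hI : ∀ p q : Idx m n, parityOp * opI (d := d) s p q =
      sg (par p + par q) • (opI s p q * parityOp) := by
    intro p q
    rw [opI, Finset.mul_sum, Finset.sum_mul, Finset.smul_sum]
    refine Finset.sum_congr rfl fun j _ => ?_
    rw [mul_smul_comm, hq _ _ _ _ (parityOp_mulOp j p) (parityOp_mulOp j.rev q), smul_comm,
      smul_mul_assoc]
  have hD : ∀ p q : Idx m n, parityOp * opDelta (d := d) s p q =
      sg (par p + par q) • (opDelta s p q * parityOp) := by
    intro p q
    rw [opDelta, Finset.mul_sum, Finset.sum_mul, Finset.smul_sum]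
    refine Finset.sum_congr rfl fun j _ => ?_
    rw [mul_smul_comm, hq _ _ _ _ (parityOp_diffOp j p) (parityOp_diffOp j.rev q), smul_comm,
      smul_mul_assoc]
  rw [rho, LinearMap.coe_mk, AddHom.coe_mk]
  simp only [Finset.mul_sum, Finset.sum_mul, Finset.smul_sum]
  refine Finset.sum_congr rfl fun p _ => Finset.sum_congr rfl fun q _ => ?_
  by_cases h : par p + par q = x
  · simp only [mul_add, mul_sub, add_mul, sub_mul, mul_smul_comm, smul_mul_assoc, hE, hI, hD, h]
    module
  · have z : ∀ i j : DIdx m n, dpar i = par p → dpar j = par q → X i j = 0 := by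
      intro i j hi hj
      rw [← hx, comp_apply, if_neg (by rw [hi, hj]; exact h)]
    rw [z (Sum.inl p) (Sum.inl q) rfl rfl, z (Sum.inl p) (Sum.inr q) rfl rfl,
      z (Sum.inr p) (Sum.inl q) rfl rfl]
    simp

/-- `ℂ[x, η]` as a module over the Lie superalgebra preserving `superForm m n τ`, for signs `s_j`
with `s_{d+1-j} = τ s_j`; its even and odd part are the eigenspaces of the parity operator. -/
def oscillator (τ : ℂ) (hτ : τ * τ = 1) (s : Fin d → ℂ) (hs : ∀ j, s j * s j = 1)
    (hr : ∀ j, s (Fin.rev j) = τ * s j) :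
    SuperModule (ortho dpar (superForm m n τ)) (PolySuper d m n) where
  grade a := LinearMap.eqLocus parityOp (sg a • LinearMap.id)
  isCompl_grade := by
    constructor
    · rw [Submodule.disjoint_def]
      intro f h0 h1
      have h0' : parityOp f = sg 0 • f := h0
      have h1' : parityOp f = sg 1 • f := h1
      rw [sg_zero, one_smul] at h0'
      rw [h0', sg_one] at h1'
      have h2 : f + f = 0 := by
        nth_rewrite 2 [h1']
        module
      have h3 : (1 / 2 : ℂ) • (f + f) = f := by module
      rw [← h3, h2, smul_zero]
    · rw [codisjoint_iff, eq_top_iff]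
      intro f _
      have hPP : parityOp (parityOp f) = f :=
        congrArg (fun T : Module.End ℂ (PolySuper d m n) => T f) parityOp_parityOp
      generalize hg : parityOp f = g at hPP
      refine Submodule.mem_sup.2 ⟨(1 / 2 : ℂ) • (f + g), ?_, (1 / 2 : ℂ) • (f - g), ?_, by module⟩
      · change parityOp _ = sg 0 • _
        rw [map_smul, map_add, hPP, hg, sg_zero, LinearMap.id_apply]
        module
      · change parityOp _ = sg 1 • _
        rw [map_smul, map_sub, hPP, hg, sg_one, LinearMap.id_apply]
        module
  act := (rho τ s).comp (ortho dpar (superForm m n τ)).subtype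
  act_mem a b X f hX hf := by
    have hX' : comp dpar a X.1 = X.1 := hX
    have hf' : parityOp f = sg b • f := hf
    have h := congrArg (fun T : Module.End ℂ (PolySuper d m n) => T f)
      (parityOp_rho (τ := τ) (s := s) hX')
    change parityOp (rho τ s X.1 f) = sg (a + b) • rho τ s X.1 f
    change parityOp (rho τ s X.1 f) = sg a • rho τ s X.1 (parityOp f) at h
    rw [h, hf', map_smul, smul_smul, sg_add]
  act_bracket a b X Y f hX hY :=
    congrArg (fun T : Module.End ℂ (PolySuper d m n) => T f)
      (rho_bracket hτ hs hr hX X.2 hY Y.2)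

end Operators

/-! ## The modules of the statement -/

/-- `S(ℂ^d ⊗ ℂ^{m|n})` as a module over `spo(2m|2n)`: all signs `s_j` are `1`. -/
def spoModule (m n d : ℕ) : SuperModule (spo m n) (PolySuper d m n) :=
  oscillator 1 (one_mul 1) (fun _ => 1) (fun _ => one_mul 1) (fun _ => (one_mul 1).symm)

/-- `S(ℂ^d ⊗ ℂ^{m|n})` for `d = 2k` as a module over `osp(2m|2n)`: `s_j = 1` for `j ≤ k` and
`s_j = -1` for `j > k`. -/
def ospModule (m n k : ℕ) : SuperModule (osp m n) (PolySuper (2 * k) m n) :=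
  oscillator (-1) (by norm_num) (fun j => if (j : ℕ) < k then 1 else -1)
    (fun j => by split_ifs <;> norm_num)
    (fun j => by
      have h := j.2
      rw [Fin.val_rev]
      by_cases h1 : (j : ℕ) < k
      · rw [if_neg (by omega), if_pos h1]; norm_num
      · rw [if_pos (by omega), if_neg h1]; norm_num)

/-- The anti-involution of `spo(2m|2n)`. -/
def spoDagger (m n : ℕ) : AntiInvolution (spo m n) := formDagger 1 (one_mul 1) (map_one _)

/-- The anti-involution of `osp(2m|2n)`. -/
def ospDagger (m n : ℕ) : AntiInvolution (osp m n) :=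
  formDagger (-1) (by norm_num) (by simp)

end HoweSuper

end

noncomputable section

namespace HoweSuper

/-! ## Hermitian forms that are diagonal in a basis -/

section BasisForm

variable {I J V W : Type*} [AddCommGroup V] [Module ℂ V] [AddCommGroup W] [Module ℂ W]

/-! The space `ℂ[x, η]` is a Fock space. Declare the monomials `x^α η_S` orthogonal, with square
length `α!`. This is the Fischer form in the even variables tensored with the standard form on the
exterior algebra, and it is positive definite. Multiplication by a variable is then adjoint to
differentiation by it: `x_i` to `∂/∂x_i` because `(α + e_i)! = (α_i + 1) α!`
(`isAdjointFor_mulLeft_X`), and `η_k` to `∂/∂η_k` because reordering produces the same sign on both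
sides (`isAdjointFor_mulLeft_ι`). Passing to adjoints therefore realizes, on the operators, the
anti-involution of the algebra of differential operators that exchanges variables and derivatives.

The Lie superalgebra acts by quadratic expressions in these operators. The adjoint of `E_{pq}` is
`E_{qp}`, and that of `I_{pq}` is `τ Δ_{qp}`, where `τ = 1` for `spo` and `τ = -1` for `osp`.
Comparing coefficients shows that the adjoint of `rho τ s X` is `rho τ s (matDagger X)`
(`isAdjointFor_rho`), so the form on the whole space is contravariant.

A form of this kind pulls back along every injective intertwiner. Every module embedded in `ℂ[x, η]`
is thus unitarizable. This includes each `V^{λ'}` of the two decompositions, which embeds as `v ⊗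
V^{λ'}` for a nonzero vector `v` of the `O(d)`- or `Sp(d)`-factor. -/

/-- The sesquilinear form in which the basis `b` is orthogonal and `b i` has square length `c i`. -/
def basisForm (b : Module.Basis I ℂ V) (c : I → ℕ) : V →ₗ[ℂ] V →ₗ⋆[ℂ] ℂ :=
  b.constr ℂ fun i =>
    { toFun := fun w => c i * conj (b.repr w i)
      map_add' := fun v w => by simp [mul_add]
      map_smul' := fun a w => by
        simp only [map_smul, Finsupp.smul_apply, smul_eq_mul, map_mul]
        ring }

theorem basisForm_basis_left (b : Module.Basis I ℂ V) (c : I → ℕ) (i : I) (w : V) :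
    basisForm b c (b i) w = c i * conj (b.repr w i) := by
  rw [basisForm, Module.Basis.constr_basis]; rfl

theorem basisForm_basis [DecidableEq I] (b : Module.Basis I ℂ V) (c : I → ℕ) (i j : I) :
    basisForm b c (b i) (b j) = if i = j then (c i : ℂ) else 0 := by
  rw [basisForm_basis_left, Module.Basis.repr_self, Finsupp.single_apply]
  by_cases h : i = j
  · simp [h]
  · simp [h, Ne.symm h]

/-- The finite set `s` is left free so that one set can serve both `(v | w)` and `(w | v)` in the
proof of Hermitian symmetry. -/
theorem basisForm_eq_sum (b : Module.Basis I ℂ V) (c : I → ℕ) (v w : V) {s : Finset I}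
    (hs : (b.repr v).support ⊆ s) :
    basisForm b c v w = ∑ i ∈ s, c i * (b.repr v i * conj (b.repr w i)) := by
  conv_lhs => rw [← b.linearCombination_repr v, Finsupp.linearCombination_apply,
    Finsupp.sum_of_support_subset (b.repr v) hs (fun i a => a • b i) fun i _ => zero_smul _ _]
  rw [map_sum, LinearMap.sum_apply]
  refine Finset.sum_congr rfl fun i _ => ?_
  rw [map_smul, LinearMap.smul_apply, basisForm_basis_left, smul_eq_mul]
  ring

theorem basisForm_symm (b : Module.Basis I ℂ V) (c : I → ℕ) (v w : V) :
    basisForm b c w v = conj (basisForm b c v w) := by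
  classical
  rw [basisForm_eq_sum b c v w (s := (b.repr v).support ∪ (b.repr w).support)
      Finset.subset_union_left,
    basisForm_eq_sum b c w v (s := (b.repr v).support ∪ (b.repr w).support)
      Finset.subset_union_right, map_sum]
  refine Finset.sum_congr rfl fun i _ => ?_
  simp only [map_mul, Complex.conj_conj, Complex.conj_natCast]
  ring

/-- Here `(v | v) = ∑ c_i |v_i|²`, summed over the support of `v`. Every term is positive and the
support is nonempty. -/
theorem basisForm_pos (b : Module.Basis I ℂ V) {c : I → ℕ} (hc : ∀ i, 0 < c i) {v : V}
    (hv : v ≠ 0) : 0 < (basisForm b c v v).re := by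
  rw [basisForm_eq_sum b c v v subset_rfl, Complex.re_sum]
  refine Finset.sum_pos (fun i hi => ?_) ?_
  · rw [Complex.mul_conj, ← Complex.ofReal_natCast, ← Complex.ofReal_mul, Complex.ofReal_re]
    exact mul_pos (Nat.cast_pos.2 (hc i)) (Complex.normSq_pos.2 (Finsupp.mem_support_iff.1 hi))
  · rw [Finsupp.support_nonempty_iff]
    simpa using hv

/-! ### Calculus of adjoint pairs of operators -/

/-- `S` and `T` are adjoint with respect to a sesquilinear form. -/
def IsAdjointFor (F : V →ₗ[ℂ] V →ₗ⋆[ℂ] ℂ) (S T : Module.End ℂ V) : Prop :=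
  ∀ v w, F (S v) w = F v (T w)

theorem isAdjointFor_of_basis (b : Module.Basis I ℂ V) {F : V →ₗ[ℂ] V →ₗ⋆[ℂ] ℂ}
    {S T : Module.End ℂ V} (h : ∀ i j, F (S (b i)) (b j) = F (b i) (T (b j))) :
    IsAdjointFor F S T := by
  have h1 : F.comp S = F.compl₂ T := b.ext fun i => b.ext fun j => h i j
  exact fun v w => congrArg (fun G : V →ₗ[ℂ] V →ₗ⋆[ℂ] ℂ => G v w) h1

theorem isAdjointFor_one (F : V →ₗ[ℂ] V →ₗ⋆[ℂ] ℂ) : IsAdjointFor F 1 1 := fun _ _ => rfl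

theorem IsAdjointFor.add {F : V →ₗ[ℂ] V →ₗ⋆[ℂ] ℂ} {S T S' T' : Module.End ℂ V}
    (h : IsAdjointFor F S T) (h' : IsAdjointFor F S' T') :
    IsAdjointFor F (S + S') (T + T') := fun v w => by
  simp only [LinearMap.add_apply, map_add, h v w, h' v w]

theorem IsAdjointFor.smul {F : V →ₗ[ℂ] V →ₗ⋆[ℂ] ℂ} {S T : Module.End ℂ V}
    (h : IsAdjointFor F S T) (c : ℂ) : IsAdjointFor F (c • S) (conj c • T) := fun v w => by
  simp only [LinearMap.smul_apply, map_smul, LinearMap.map_smulₛₗ, h v w, Complex.conj_conj]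

theorem IsAdjointFor.sub {F : V →ₗ[ℂ] V →ₗ⋆[ℂ] ℂ} {S T S' T' : Module.End ℂ V}
    (h : IsAdjointFor F S T) (h' : IsAdjointFor F S' T') :
    IsAdjointFor F (S - S') (T - T') := fun v w => by
  simp only [LinearMap.sub_apply, map_sub, h v w, h' v w]

/-- Order is reversed without a super sign, whatever the parities. This is why the matching
anti-involution satisfies `[a, b]† = [b†, a†]` without signs. -/
theorem IsAdjointFor.mul {F : V →ₗ[ℂ] V →ₗ⋆[ℂ] ℂ} {S T S' T' : Module.End ℂ V}
    (h : IsAdjointFor F S T) (h' : IsAdjointFor F S' T') :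
    IsAdjointFor F (S * S') (T' * T) := fun v w => by
  rw [Module.End.mul_apply, Module.End.mul_apply, h, h']

theorem isAdjointFor_sum {F : V →ₗ[ℂ] V →ₗ⋆[ℂ] ℂ} {s : Finset J} {S T : J → Module.End ℂ V}
    (h : ∀ j, IsAdjointFor F (S j) (T j)) :
    IsAdjointFor F (∑ j ∈ s, S j) (∑ j ∈ s, T j) := fun v w => by
  simp only [LinearMap.sum_apply, map_sum, h _ v w]

/-- Hermitian symmetry makes adjointness mutual, so for each variable it suffices to find the
adjoint of the multiplication operator. -/
theorem IsAdjointFor.symm {F : V →ₗ[ℂ] V →ₗ⋆[ℂ] ℂ} (hF : ∀ v w, F w v = conj (F v w))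
    {S T : Module.End ℂ V} (h : IsAdjointFor F S T) : IsAdjointFor F T S := fun v w => by
  rw [hF, ← h, ← hF]

/-! ### Tensor products of diagonal forms -/

theorem basisForm_tmul (b : Module.Basis I ℂ V) (c : I → ℕ) (b' : Module.Basis J ℂ W)
    (c' : J → ℕ) (v v' : V) (w w' : W) :
    basisForm (b.tensorProduct b') (fun i => c i.1 * c' i.2) (v ⊗ₜ w) (v' ⊗ₜ w') =
      basisForm b c v v' * basisForm b' c' w w' := by
  have h0 : ∀ i j, basisForm (b.tensorProduct b') (fun i => c i.1 * c' i.2) (b i ⊗ₜ b' j)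
      (v' ⊗ₜ w') = basisForm b c (b i) v' * basisForm b' c' (b' j) w' := by
    intro i j
    rw [← Module.Basis.tensorProduct_apply, basisForm_basis_left, basisForm_basis_left,
      basisForm_basis_left, Module.Basis.tensorProduct_repr_tmul_apply]
    simp only [Nat.cast_mul, smul_eq_mul, map_mul]
    ring
  -- With `v'` and `w'` fixed, both sides are bilinear in `(v, w)`, hence determined by basis
  -- vectors. The conjugate-linear slots need no extension argument, since `h0` already allows
  -- arbitrary `v'` and `w'`.
  have h1 : (TensorProduct.mk ℂ V W).compr₂
      ((basisForm (b.tensorProduct b') fun i => c i.1 * c' i.2).flip (v' ⊗ₜ w')) =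
      (LinearMap.mul ℂ ℂ).compl₁₂ ((basisForm b c).flip v') ((basisForm b' c').flip w') :=
    b.ext fun i => b'.ext fun j => h0 i j
  exact congrArg (fun G : V →ₗ[ℂ] W →ₗ[ℂ] ℂ => G v w) h1

/-- The form factors on pure tensors and the tensor product of operators carries no sign, so
adjoints can be taken factor by factor. -/
theorem isAdjointFor_map (b : Module.Basis I ℂ V) (c : I → ℕ) (b' : Module.Basis J ℂ W)
    (c' : J → ℕ) {S S' : Module.End ℂ V} {T T' : Module.End ℂ W}
    (hS : IsAdjointFor (basisForm b c) S S') (hT : IsAdjointFor (basisForm b' c') T T') :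
    IsAdjointFor (basisForm (b.tensorProduct b') (fun i => c i.1 * c' i.2))
      (TensorProduct.map S T) (TensorProduct.map S' T') := by
  refine isAdjointFor_of_basis (b.tensorProduct b') fun i j => ?_
  rw [Module.Basis.tensorProduct_apply', Module.Basis.tensorProduct_apply',
    TensorProduct.map_tmul, TensorProduct.map_tmul, basisForm_tmul, basisForm_tmul, hS, hT]

end BasisForm

/-! ## The Fischer form on polynomials -/

section Fischer

variable {σ : Type*} [Fintype σ]

/-- On monomials, `(x_i x^α | x^β)` and `(x^α | β_i x^{β - e_i})` both vanish unless `β = α + e_i`.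
In that case they are `(α + e_i)!` and `(α_i + 1) α!`, which agree. -/
theorem isAdjointFor_mulLeft_X (i : σ) :
    IsAdjointFor (basisForm (MvPolynomial.basisMonomials σ ℂ) fun α => ∏ k, (α k).factorial)
      (LinearMap.mulLeft ℂ (MvPolynomial.X i)) (MvPolynomial.pderiv i).toLinearMap := by
  classical
  refine isAdjointFor_of_basis (MvPolynomial.basisMonomials σ ℂ) fun α β => ?_
  have h1 : LinearMap.mulLeft ℂ (MvPolynomial.X i) (MvPolynomial.basisMonomials σ ℂ α) =
      MvPolynomial.basisMonomials σ ℂ (Finsupp.single i 1 + α) := by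
    simp [MvPolynomial.X, MvPolynomial.monomial_mul]
  have h2 : (MvPolynomial.pderiv i).toLinearMap (MvPolynomial.basisMonomials σ ℂ β) =
      (β i : ℂ) • MvPolynomial.basisMonomials σ ℂ (β - Finsupp.single i 1) := by
    simp [MvPolynomial.pderiv_monomial, MvPolynomial.smul_monomial]
  rw [h1, h2, LinearMap.map_smulₛₗ, basisForm_basis, basisForm_basis, Complex.conj_natCast,
    smul_eq_mul]
  by_cases h : Finsupp.single i 1 + α = β
  · subst h
    have hα : α = Finsupp.single i 1 + α - Finsupp.single i 1 := by rw [add_tsub_cancel_left]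
    -- The factor at `i` is split off both products of factorials: there the identity is `(α_i + 1)!
    -- = (α_i + 1) α_i!`, and all other factors coincide.
    rw [if_pos rfl, if_pos hα, ← Nat.cast_mul, ← Finset.mul_prod_erase _ _ (Finset.mem_univ i),
      ← Finset.mul_prod_erase _ (fun k => (α k).factorial) (Finset.mem_univ i), ← mul_assoc]
    congr 2
    · simp [add_comm 1, Nat.factorial_succ]
    · refine Finset.prod_congr rfl fun k hk => ?_
      rw [Finsupp.add_apply, Finsupp.single_eq_of_ne (Finset.ne_of_mem_erase hk), zero_add]
  · rw [if_neg h]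
    -- Subtraction of exponents is truncated. If `β_i = 0`, the coefficient `β_i` kills the term;
    -- otherwise `α = β - e_i` would give `e_i + α = β`.
    by_cases h' : β i = 0
    · simp [h']
    · rw [if_neg, mul_zero]
      rintro rfl
      refine h (add_tsub_cancel_of_le ?_)
      rw [Finsupp.single_le_iff]
      omega

end Fischer

/-! ## The form on the exterior algebra -/

section Exterior

open ExteriorAlgebra

variable {K : Type*} [Fintype K] [LinearOrder K]

/-- The monomials in the odd variables. -/
abbrev extBasis (K : Type*) [Fintype K] [LinearOrder K] :
    Module.Basis (Finset K) ℂ (ExteriorAlgebra ℂ (K → ℂ)) :=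
  (Pi.basisFun ℂ K).ExteriorAlgebra

theorem extBasis_empty : extBasis K ∅ = 1 := by
  rw [basis_apply_ofCard _ Finset.card_empty, ExteriorAlgebra.ιMulti_family]
  simp

theorem extBasis_singleton (k : K) : extBasis K {k} = ι ℂ (Pi.single k 1) := by
  rw [basis_apply_ofCard _ (Finset.card_singleton k), ExteriorAlgebra.ιMulti_family]
  -- The basis vector is the product over the increasing enumeration of the set, and for `{k}` the
  -- only entry of the enumeration is `k`.
  have h : Set.powersetCard.ofFinEmbEquiv.symm
      (Set.powersetCard.ofCard (Finset.card_singleton k)) 0 = k := by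
    have h1 := Set.powersetCard.mem_range_ofFinEmbEquiv_symm_iff_mem
      (Set.powersetCard.ofCard (Finset.card_singleton k))
      (Set.powersetCard.ofFinEmbEquiv.symm
        (Set.powersetCard.ofCard (Finset.card_singleton k)) 0)
    exact Finset.mem_singleton.1 (h1.1 ⟨0, rfl⟩)
  simp [h]

theorem ι_mul_extBasis_of_mem {k : K} {S : Finset K} (h : k ∈ S) :
    ι ℂ (Pi.single k 1) * extBasis K S = 0 := by
  rw [← extBasis_singleton]
  exact basis_mul_of_not_disjoint (Pi.basisFun ℂ K) (Set.powersetCard.ofCard (Finset.card_singleton k))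
    (Set.powersetCard.ofCard (rfl : S.card = S.card)) (by simpa using h)

/-- The sign of the reordering permutation never has to be computed: only `ε² = 1` is used. Taking
`ε` in `ℤ` makes it invariant under conjugation. -/
theorem ι_mul_extBasis_of_notMem {k : K} {S : Finset K} (h : k ∉ S) :
    ∃ ε : ℤ, ε * ε = 1 ∧
      ι ℂ (Pi.single k 1) * extBasis K S = (ε : ℂ) • extBasis K (insert k S) := by
  have hd : Disjoint (Set.powersetCard.ofCard (Finset.card_singleton k)).val
    (Set.powersetCard.ofCard (rfl : S.card = S.card)).val := by simpa using h
  have h1 := basis_mul_of_disjoint (Pi.basisFun ℂ K) _ _ hd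
  refine ⟨(Set.powersetCard.permOfDisjoint hd).sign, by simp [← Units.val_mul], ?_⟩
  have h2 : (Set.powersetCard.disjUnion hd).val = insert k S := by
    ext a
    simp [Set.powersetCard.disjUnion]
  rw [h2] at h1
  rw [← extBasis_singleton, Int.cast_smul_eq_zsmul]
  exact h1

/-- By induction on `S`: up to sign, a factor `η_a` with `a ≠ k` can be pulled to the front. The odd
derivation `∂/∂η_k` kills `η_a`, and by induction it kills the remaining product. -/
theorem contractLeft_extBasis_of_notMem {k : K} {S : Finset K} (h : k ∉ S) :
    CliffordAlgebra.contractLeft (Q := (0 : QuadraticForm ℂ (K → ℂ))) (LinearMap.proj k)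
      (extBasis K S) = 0 := by
  induction S using Finset.induction_on with
  | empty => rw [extBasis_empty]; exact CliffordAlgebra.contractLeft_one (Q := 0) _
  | insert a S ha ih =>
    obtain ⟨ε, hε, h1⟩ := ι_mul_extBasis_of_notMem ha
    have h2 : extBasis K (insert a S) = (ε : ℂ) • (ι ℂ (Pi.single a 1) * extBasis K S) := by
      rw [h1, smul_smul, ← Int.cast_mul, hε, Int.cast_one, one_smul]
    rw [Finset.mem_insert, not_or] at h
    rw [h2, map_smul, ι, CliffordAlgebra.contractLeft_ι_mul, ih h.2, LinearMap.proj_apply,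
      Pi.single_eq_of_ne h.1, zero_smul, mul_zero, sub_zero, smul_zero]

theorem contractLeft_ι_mul_extBasis {k : K} {S : Finset K} (h : k ∉ S) :
    CliffordAlgebra.contractLeft (Q := (0 : QuadraticForm ℂ (K → ℂ))) (LinearMap.proj k)
      (ι ℂ (Pi.single k 1) * extBasis K S) = extBasis K S := by
  rw [ι, CliffordAlgebra.contractLeft_ι_mul, contractLeft_extBasis_of_notMem h,
    LinearMap.proj_apply, Pi.single_eq_same, one_smul, mul_zero, sub_zero]

/-- Both `(η_k η_S | η_T)` and `(η_S | ∂_k η_T)` vanish unless `k ∉ S` and `T = S ∪ {k}`. Then both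
equal the sign `ε` in `η_k η_S = ε η_T`, because `∂_k η_T = ε ∂_k (η_k η_S) = ε η_S`. -/
theorem isAdjointFor_mulLeft_ι (k : K) :
    IsAdjointFor (basisForm (extBasis K) fun _ => 1)
      (LinearMap.mulLeft ℂ (ι ℂ (Pi.single k 1)))
      (CliffordAlgebra.contractLeft (Q := (0 : QuadraticForm ℂ (K → ℂ))) (LinearMap.proj k)) := by
  refine isAdjointFor_of_basis (extBasis K) fun S T => ?_
  rw [LinearMap.mulLeft_apply]
  by_cases hT : k ∈ T
  · obtain ⟨T, hT', rfl⟩ : ∃ T', k ∉ T' ∧ insert k T' = T :=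
      ⟨T.erase k, Finset.notMem_erase k T, Finset.insert_erase hT⟩
    obtain ⟨ε, hε, h1⟩ := ι_mul_extBasis_of_notMem hT'
    have h2 : extBasis K (insert k T) = (ε : ℂ) • (ι ℂ (Pi.single k 1) * extBasis K T) := by
      rw [h1, smul_smul, ← Int.cast_mul, hε, Int.cast_one, one_smul]
    have h3 : CliffordAlgebra.contractLeft (Q := (0 : QuadraticForm ℂ (K → ℂ)))
        (LinearMap.proj k) (extBasis K (insert k T)) = (ε : ℂ) • extBasis K T := by
      rw [h2, map_smul, contractLeft_ι_mul_extBasis hT']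
    rw [h3, LinearMap.map_smulₛₗ, map_intCast]
    by_cases hS : k ∈ S
    · rw [ι_mul_extBasis_of_mem hS, map_zero, LinearMap.zero_apply, basisForm_basis, if_neg,
        smul_zero]
      rintro rfl
      exact hT' hS
    · obtain ⟨ε', -, h1'⟩ := ι_mul_extBasis_of_notMem hS
      by_cases h : S = T
      · subst h
        rw [h1, map_smul, LinearMap.smul_apply, basisForm_basis, basisForm_basis, if_pos rfl,
          if_pos rfl]
      · rw [h1', map_smul, LinearMap.smul_apply, basisForm_basis, basisForm_basis, if_neg h,
          if_neg, smul_zero, smul_zero]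
        -- Adjoining `k` is injective on sets that do not contain `k`, so distinct `S` and `T` give
        -- distinct, hence orthogonal, monomials.
        intro h'
        exact h (by rw [← Finset.erase_insert hS, h', Finset.erase_insert hT'])
  · rw [contractLeft_extBasis_of_notMem hT, map_zero]
    by_cases hS : k ∈ S
    · rw [ι_mul_extBasis_of_mem hS, map_zero, LinearMap.zero_apply]
    · obtain ⟨ε, -, h1⟩ := ι_mul_extBasis_of_notMem hS
      rw [h1, map_smul, LinearMap.smul_apply, basisForm_basis, if_neg, smul_zero]
      rintro rfl
      exact hT (Finset.mem_insert_self k S)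

end Exterior

/-! ## The form on `ℂ[x, η]` -/

section PolySuperForm

variable {d m n : ℕ}

/-- The form on polynomials tensor the exterior algebra in which the monomials are orthogonal and
the monomial with exponents `α` in the even variables has square length `α!`. -/
def monomialForm (σ K : Type*) [Fintype σ] [Fintype K] [LinearOrder K] :
    (MvPolynomial σ ℂ ⊗[ℂ] ExteriorAlgebra ℂ (K → ℂ)) →ₗ[ℂ]
      (MvPolynomial σ ℂ ⊗[ℂ] ExteriorAlgebra ℂ (K → ℂ)) →ₗ⋆[ℂ] ℂ :=
  basisForm ((MvPolynomial.basisMonomials σ ℂ).tensorProduct (extBasis K))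
    -- The trailing `1` is the weight of the exterior monomials, kept so that the weight has the
    -- product shape required by `isAdjointFor_map`.
    fun i => (∏ k, (i.1 k).factorial) * 1

section MonomialForm

variable {σ K : Type*} [Fintype σ] [Fintype K] [LinearOrder K]

theorem isAdjointFor_monomialForm_X (i : σ) : IsAdjointFor (monomialForm σ K)
    (TensorProduct.map (LinearMap.mulLeft ℂ (MvPolynomial.X i)) LinearMap.id)
    (TensorProduct.map (MvPolynomial.pderiv i).toLinearMap LinearMap.id) :=
  isAdjointFor_map (MvPolynomial.basisMonomials σ ℂ) (fun α => ∏ k, (α k).factorial)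
    (extBasis K) (fun _ => 1) (isAdjointFor_mulLeft_X i) (isAdjointFor_one _)

/-- `Pi.single` depends on a decidable equality on `K`. Stating the result for any `v` equal to it
allows `v` to be formed with another instance than that of the linear order, as happens for `mulOp`.
-/
theorem isAdjointFor_monomialForm_ι {k : K} {v : K → ℂ} (hv : v = Pi.single k 1) :
    IsAdjointFor (monomialForm σ K)
    (TensorProduct.map LinearMap.id (LinearMap.mulLeft ℂ (ExteriorAlgebra.ι ℂ v)))
    (TensorProduct.map LinearMap.id
      (CliffordAlgebra.contractLeft (Q := (0 : QuadraticForm ℂ (K → ℂ)))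
        (LinearMap.proj k))) := by
  subst hv
  exact isAdjointFor_map (MvPolynomial.basisMonomials σ ℂ) (fun α => ∏ k, (α k).factorial)
    (extBasis K) (fun _ => 1) (isAdjointFor_one _) (isAdjointFor_mulLeft_ι k)

theorem monomialForm_symm (v w : MvPolynomial σ ℂ ⊗[ℂ] ExteriorAlgebra ℂ (K → ℂ)) :
    monomialForm σ K w v = conj (monomialForm σ K v w) :=
  basisForm_symm _ _ v w

theorem monomialForm_pos {v : MvPolynomial σ ℂ ⊗[ℂ] ExteriorAlgebra ℂ (K → ℂ)} (hv : v ≠ 0) :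
    0 < (monomialForm σ K v v).re :=
  basisForm_pos _ (fun _ => Nat.mul_pos (Finset.prod_pos fun _ _ => Nat.factorial_pos _)
    one_pos) hv

end MonomialForm

theorem exists_form_mulOp_diffOp (d m n : ℕ) :
    ∃ F : PolySuper d m n →ₗ[ℂ] PolySuper d m n →ₗ⋆[ℂ] ℂ,
      (∀ v w, F w v = conj (F v w)) ∧ (∀ v, v ≠ 0 → 0 < (F v v).re) ∧
      ∀ j p, IsAdjointFor F (mulOp j p) (diffOp j p) := by
  -- A total order on the odd variables is needed to write down the monomial basis. It does not
  -- appear in the conclusion.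
  let : LinearOrder (Fin d × Fin n) := LinearOrder.lift' finProdFinEquiv (Equiv.injective _)
  refine ⟨monomialForm (Fin d × Fin m) (Fin d × Fin n), monomialForm_symm,
    fun v hv => monomialForm_pos hv, ?_⟩
  rintro j (i | k)
  · exact isAdjointFor_monomialForm_X (j, i)
  · exact isAdjointFor_monomialForm_ι (by congr!)

/-! ### Contravariance under the Lie superalgebra -/

variable {F : PolySuper d m n →ₗ[ℂ] PolySuper d m n →ₗ⋆[ℂ] ℂ}

/-- The adjoint of `z_p ∂_q` is `z_q ∂_p`, and the added constant is real and occurs only for `p =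
q`. -/
theorem isAdjointFor_opE (hF : ∀ v w, F w v = conj (F v w))
    (h : ∀ j p, IsAdjointFor F (mulOp j p) (diffOp j p)) (p q : Idx m n) :
    IsAdjointFor F (opE p q) (opE q p) := by
  refine (isAdjointFor_sum fun j => (h j p).mul ((h j q).symm hF)).add ?_
  convert (isAdjointFor_one F).smul (if p = q then sg (par p) * ((d : ℂ) / 2) else 0) using 2
  by_cases hpq : p = q
  · subst hpq
    simp only [if_true, map_mul, star_sg, map_div₀, Complex.conj_natCast, map_ofNat]
  · simp [hpq, Ne.symm hpq]

/-- The adjoint of `s_j z_p^j z_q^{d+1-j}` is `s_j ∂_q^{d+1-j} ∂_p^j`. Reindexing by `j ↦ d+1-j`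
gives the terms of `Δ_{qp}`, and the factor `τ` comes from `s_{d+1-j} = τ s_j`. -/
theorem isAdjointFor_opI {τ : ℂ} {s : Fin d → ℂ} (hs : ∀ j, conj (s j) = s j)
    (hr : ∀ j, s (Fin.rev j) = τ * s j)
    (h : ∀ j p, IsAdjointFor F (mulOp j p) (diffOp j p)) (p q : Idx m n) :
    IsAdjointFor F (opI s p q) (τ • opDelta s q p) := by
  have h1 : τ • opDelta s q p = ∑ j, conj (s j) • (diffOp j.rev q * diffOp j p) := by
    rw [opDelta, ← Equiv.sum_comp Fin.revPerm, Finset.smul_sum]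
    refine Finset.sum_congr rfl fun j _ => ?_
    have h2 := hr j.rev
    rw [Fin.rev_rev] at h2
    simp only [Fin.revPerm_apply, Fin.rev_rev]
    rw [smul_smul, ← h2, hs]
  rw [h1]
  exact isAdjointFor_sum fun j => ((h j p).mul (h j.rev q)).smul (s j)

/-- Taking adjoints transposes and conjugates the block of the `E_{pq}` and exchanges the blocks of
the `I_{pq}` and `Δ_{pq}`. The entries `-(-1)^{deg p}` of `K` in `matDagger` absorb the different
normalizations of these two blocks. No relation between the blocks enters, so `X` may be any matrix.
-/
theorem isAdjointFor_rho {τ : ℂ} (hτ : τ * τ = 1) (hτ' : conj τ = τ) {s : Fin d → ℂ}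
    (hs : ∀ j, conj (s j) = s j) (hr : ∀ j, s (Fin.rev j) = τ * s j)
    (hF : ∀ v w, F w v = conj (F v w))
    (h : ∀ j p, IsAdjointFor F (mulOp j p) (diffOp j p)) (X : Matrix (DIdx m n) (DIdx m n) ℂ) :
    IsAdjointFor F (rho τ s X) (rho τ s (matDagger X)) := by
  have hI := isAdjointFor_opI hs hr h
  have hD : ∀ p q : Idx m n, IsAdjointFor F (opDelta s p q) (τ • opI s q p) := by
    intro p q
    have h1 := ((hI q p).symm hF).smul τ
    rwa [smul_smul, hτ, one_smul, hτ'] at h1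
  -- The placeholders are filled by the adjoint calculus: they become the `(p, q)` summand of `rho τ
  -- s X` and its termwise adjoint.
  have key : ∀ p q : Idx m n, IsAdjointFor F _ _ := fun p q =>
    (((isAdjointFor_opE hF h p q).smul (X (Sum.inl p) (Sum.inl q))).add
      ((hI p q).smul (1 / 2 * X (Sum.inl p) (Sum.inr q)))).sub
      ((hD p q).smul (τ / 2 * sg (par p) * X (Sum.inr p) (Sum.inl q)))
  have h2 : rho τ s (matDagger X) = ∑ p, ∑ q,
      (conj (X (Sum.inl p) (Sum.inl q)) • opE q p +
        conj (1 / 2 * X (Sum.inl p) (Sum.inr q)) • (τ • opDelta s q p) -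
        conj (τ / 2 * sg (par p) * X (Sum.inr p) (Sum.inl q)) • (τ • opI s q p)) := by
    -- Interchanging the sums matches the `(q, p)` entries of `matDagger X` with the `(p, q)`
    -- entries of `X`. The `I`-coefficients then agree by `τ² = 1`, the `Δ`-coefficients by
    -- `((-1)^{deg q})² = 1`.
    rw [rho, LinearMap.coe_mk, AddHom.coe_mk, Finset.sum_comm]
    refine Finset.sum_congr rfl fun p _ => Finset.sum_congr rfl fun q _ => ?_
    simp only [matDagger_apply, daggerSign, Sum.elim_inl, Sum.elim_inr, map_mul, map_div₀,
      map_one, map_ofNat, star_sg, hτ', smul_smul]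
    have h3 := sg_mul_self (par q)
    match_scalars
    · ring
    · linear_combination (1 / 2 * sg (par p) * conj (X (Sum.inr p) (Sum.inl q))) * hτ
    · linear_combination (1 / 2 * τ * conj (X (Sum.inl p) (Sum.inr q))) * h3
  rw [h2]
  exact isAdjointFor_sum fun p => isAdjointFor_sum fun q => key p q

/-- The form is pulled back along the embedding `φ`: injectivity keeps it positive definite, and the
intertwining property transfers contravariance. Since the form involves no super signs, the parity
of `φ` plays no role. -/
theorem isUnitarizable_of_occursIn_oscillator {τ : ℂ} (hτ : τ * τ = 1) (hτ' : conj τ = τ)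
    {s : Fin d → ℂ} (hs : ∀ j, s j * s j = 1) (hs' : ∀ j, conj (s j) = s j)
    (hr : ∀ j, s (Fin.rev j) = τ * s j) {V : Type*} [AddCommGroup V] [Module ℂ V]
    (M : SuperModule (ortho dpar (superForm m n τ)) V)
    (hM : M.OccursIn (oscillator τ hτ s hs hr)) :
    M.IsUnitarizable (formDagger τ hτ hτ') := by
  obtain ⟨φ, hφ, hact⟩ := hM
  obtain ⟨F, hF, hpos, h⟩ := exists_form_mulOp_diffOp d m n
  refine ⟨(F.comp φ).compl₂ φ, fun v w => ?_, fun v hv => ?_, fun X v w => ?_⟩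
  · exact hF (φ v) (φ w)
  · exact hpos (φ v) ((map_ne_zero_iff φ hφ).2 hv)
  · rw [LinearMap.compl₂_apply, LinearMap.compl₂_apply, LinearMap.comp_apply,
      LinearMap.comp_apply, hact, hact]
    exact isAdjointFor_rho hτ hτ' hs' hr hF h X.1 (φ v) (φ w)

end PolySuperForm

end HoweSuper

end

theorem mainTheorem12 (m n : ℕ) :
    (∀ (d : ℕ) (V : Type*) [AddCommGroup V] [Module ℂ V]
      (M : HoweSuper.SuperModule (HoweSuper.spo m n) V),
      M.OccursIn (HoweSuper.spoModule m n d) →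
      M.IsUnitarizable (HoweSuper.spoDagger m n)) ∧
    (∀ (k : ℕ) (V : Type*) [AddCommGroup V] [Module ℂ V]
      (M : HoweSuper.SuperModule (HoweSuper.osp m n) V),
      M.OccursIn (HoweSuper.ospModule m n k) →
      M.IsUnitarizable (HoweSuper.ospDagger m n)) := by
  refine ⟨fun d V _ _ M hM => ?_, fun k V _ _ M hM => ?_⟩
  · exact HoweSuper.isUnitarizable_of_occursIn_oscillator _ _ _ (fun _ => map_one _) _ M hM
  -- What remains is that the signs `s_j = ±1` are real.
  · refine HoweSuper.isUnitarizable_of_occursIn_oscillator _ _ _ (fun j => ?_) _ M hM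
    split_ifs <;> simp
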